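/- Let $N\ge 1$ and $m\ge 1$ be integers, let $\rho_2,\dots,\rho_N\in(-1,1)$ and $\mu_1,\dots,\mu_N\in(-1,1)$, and let $\hat x_{n,k},\hat y_{n,k},x_{n,k},y_{n,k}$ ($1\le n\le N$, $1\le k\le m$) be independent real Gaussian random variables with mean $0$ and variance $1/2$. Define the estimated channels $$\hat g_{1,k}=\hat x_{1,k}+\jmath\hat y_{1,k},\qquad \hat g_{n,k}=\sqrt{1-\rho_n^2}\,\hat x_{n,k}+\rho_n\hat x_{1,k}+\jmath\big(\sqrt{1-\rho_n^2}\,\hat y_{n,k}+\rho_n\hat y_{1,k}\big)\quad(2\le n\le N),$$ the actual (outdated) channels $g_{n,k}=\sqrt{1-\mu_n^2}\,(x_{n,k}+\jmath y_{n,k})+\mu_n\hat g_{n,k}$, and the gains $\hat h_n=\sum_{k=1}^m|\hat g_{n,k}|^2$ and $h_n=\sum_{k=1}^m|g_{n,k}|^2$. Let $s$ be a random index in $\{1,\dots,N\}$ with $\hat h_s=\max_n\hat h_n$ (the activated port; ties are broken arbitrarily), let $E_n=\{s=n\}$, and let $h=h_s$ be the gain of the activated port. Let $I_\nu$ be the modified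 Bessel function of the first kind and, for $a,b\ge 0$, let $$Q_m(a,b)=\int_b^\infty t\Big(\frac ta\Big)^{m-1}e^{-(t^2+a^2)/2}I_{m-1}(at)\,dt,\qquad Q_m(0,b)=\frac{\Gamma(m,b^2/2)}{\Gamma(m)},$$ be the Marcum $Q$-function of order $m$. Put $\phi_n(z,x)=1-Q_m\Big(\sqrt{\tfrac{2z\rho_n^2}{1-\rho_n^2}},\sqrt{\tfrac{2x}{1-\rho_n^2}}\Big)$ and, for $x>0$, $$f_{\hat h_1|E_1}(x)=\frac{1}{\Gamma(m)}e^{-x}x^{m-1}\prod_{k=2}^N\phi_k(x,x),$$ $$f_{\hat h_n|E_n}(x)=\frac{1}{\Gamma(m)(1-\rho_n^2)}\int_0^x e^{-\frac{x+z}{1-\rho_n^2}}\Big(\frac{xz}{\rho_n^2}\Big)^{\frac{m-1}{2}}I_{m-1}\Big(\frac{2\sqrt{xz\rho_n^2}}{1-\rho_n^2}\Big)\prod_{\substack{k=2\\k\ne n}}^N\phi_k(z,x)\,dz\qquad(2\le n\le N),$$ where for $\rho_n=0$ the product of the power and the Bessel function is replaced by its limit $(xz)^{m-1}/\Gamma(m)$.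 Then $f_{\hat h_n|E_n}\ge 0$ is the density of $\hat h_n$ on the event $E_n$, that is, $\mathbb P(E_n\cap\{\hat h_n\in A\})=\int_{A\cap(0,\infty)}f_{\hat h_n|E_n}(y)\,dy$ for every Borel set $A\subseteq\mathbb R$ and every $n$; and for every $x\ge 0$ the cumulative distribution function $F_h(x)=\mathbb P(h\le x)$ is $$F_h(x)=1-\sum_{n=1}^N\int_0^\infty Q_m\Big(\sqrt{\tfrac{2y\mu_n^2}{1-\mu_n^2}},\sqrt{\tfrac{2x}{1-\mu_n^2}}\Big)f_{\hat h_n|E_n}(y)\,dy,$$ where all the integrals converge. -/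

import Mathlib

open MeasureTheory ProbabilityTheory Set

noncomputable section

namespace FluidAntenna

/-- The modified Bessel function of the first kind `I_ν(x)` of natural order `ν`. -/
def besselI (ν : ℕ) (x : ℝ) : ℝ :=
  ∑' k : ℕ, (x / 2) ^ (2 * k + ν) / ((k.factorial : ℝ) * ((k + ν).factorial : ℝ))

/-- The generalized Marcum `Q`-function `Q_m(a, b)` for `m ≥ 1` and `a, b ≥ 0`; the value at
`a = 0` is the limit `Γ(m, b²/2) / Γ(m)`. -/
def marcumQ (m : ℕ) (a b : ℝ) : ℝ :=
  if a = 0 then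
    (∫ t in Ioi (b ^ 2 / 2), t ^ (m - 1) * Real.exp (-t)) / Real.Gamma m
  else
    ∫ t in Ioi b, t * (t / a) ^ (m - 1) * Real.exp (-(t ^ 2 + a ^ 2) / 2) * besselI (m - 1) (a * t)

/-- The estimated channel `ĝ_{n,k}`; the first port has index `0`. -/
def estChannel {Ω : Type*} {N m : ℕ} [NeZero N] (ρ : Fin N → ℝ)
    (xh yh : Fin N → Fin m → Ω → ℝ) (n : Fin N) (k : Fin m) (ω : Ω) : ℂ :=
  if n = 0 then
    (xh 0 k ω : ℂ) + Complex.I * (yh 0 k ω : ℂ)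
  else
    ((√(1 - ρ n ^ 2) * xh n k ω + ρ n * xh 0 k ω : ℝ) : ℂ)
      + Complex.I * ((√(1 - ρ n ^ 2) * yh n k ω + ρ n * yh 0 k ω : ℝ) : ℂ)

/-- The actual channel `g_{n,k}`, a combination of the estimate and a fresh Gaussian term. -/
def outdatedChannel {Ω : Type*} {N m : ℕ} [NeZero N] (ρ μ : Fin N → ℝ)
    (xh yh x y : Fin N → Fin m → Ω → ℝ) (n : Fin N) (k : Fin m) (ω : Ω) : ℂ :=
  (√(1 - μ n ^ 2) : ℂ) * ((x n k ω : ℂ) + Complex.I * (y n k ω : ℂ))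
    + (μ n : ℂ) * estChannel ρ xh yh n k ω

/-- The estimated gain `ĥ_n = ∑_k |ĝ_{n,k}|²`. -/
def estGain {Ω : Type*} {N m : ℕ} [NeZero N] (ρ : Fin N → ℝ)
    (xh yh : Fin N → Fin m → Ω → ℝ) (n : Fin N) (ω : Ω) : ℝ :=
  ∑ k, ‖estChannel ρ xh yh n k ω‖ ^ 2

/-- The actual gain `h_n = ∑_k |g_{n,k}|²`. -/
def outdatedGain {Ω : Type*} {N m : ℕ} [NeZero N] (ρ μ : Fin N → ℝ)
    (xh yh x y : Fin N → Fin m → Ω → ℝ) (n : Fin N) (ω : Ω) : ℝ :=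
  ∑ k, ‖outdatedChannel ρ μ xh yh x y n k ω‖ ^ 2

/-- All the entries of the four arrays are independent `𝒩(0, 1/2)` variables. -/
structure IsGaussianModel {Ω : Type*} [MeasurableSpace Ω] (P : Measure Ω) {N m : ℕ}
    (xh yh x y : Fin N → Fin m → Ω → ℝ) : Prop where
  law_xh : ∀ n k, HasLaw (xh n k) (gaussianReal 0 (1 / 2)) P
  law_yh : ∀ n k, HasLaw (yh n k) (gaussianReal 0 (1 / 2)) P
  law_x : ∀ n k, HasLaw (x n k) (gaussianReal 0 (1 / 2)) P
  law_y : ∀ n k, HasLaw (y n k) (gaussianReal 0 (1 / 2)) P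
  indep : iIndepFun
    (fun i : Fin 4 × Fin N × Fin m => (![xh, yh, x, y] i.1) i.2.1 i.2.2) P

/-- `φ(z, x) = 1 - Q_m(√(2zρ²/(1-ρ²)), √(2x/(1-ρ²)))`. -/
def phi (m : ℕ) (ρ z x : ℝ) : ℝ :=
  1 - marcumQ m (√(2 * z * ρ ^ 2 / (1 - ρ ^ 2))) (√(2 * x / (1 - ρ ^ 2)))

/-- The factor `(xz/ρ²)^{(m-1)/2} I_{m-1}(2√(xzρ²)/(1-ρ²))`, with its limit
`(xz)^{m-1}/Γ(m)` as the value at `ρ = 0`. -/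
def besselFactor (m : ℕ) (ρ x z : ℝ) : ℝ :=
  if ρ = 0 then (x * z) ^ (m - 1) / Real.Gamma m
  else (x * z / ρ ^ 2) ^ (((m : ℝ) - 1) / 2)
    * besselI (m - 1) (2 * √(x * z * ρ ^ 2) / (1 - ρ ^ 2))

/-- The density `f_{ĥ_n | E_n}(x)` for `x > 0`; the first port has index `0`. -/
def selPdf (m : ℕ) {N : ℕ} [NeZero N] (ρ : Fin N → ℝ) (n : Fin N) (x : ℝ) : ℝ :=
  if n = 0 then
    1 / Real.Gamma m * Real.exp (-x) * x ^ (m - 1)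
      * ∏ k ∈ Finset.univ.erase (0 : Fin N), phi m (ρ k) x x
  else
    1 / (Real.Gamma m * (1 - ρ n ^ 2)) *
      ∫ z in (0 : ℝ)..x, Real.exp (-((x + z) / (1 - ρ n ^ 2))) * besselFactor m (ρ n) x z
        * ∏ k ∈ (Finset.univ.erase (0 : Fin N)).erase n, phi m (ρ k) z x

end FluidAntenna

end

/-!
Given the vector `v` behind the estimate of the first port, the estimated gains are independent:
the first one is the constant `|v|²` and, by a characteristic function computation, the others are
scaled noncentral `χ²` variables whose noncentrality depends on `v` only through `|v|²`. Their tails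
are Marcum `Q`-functions, so the product of the `φ_k` is the probability that the other gains stay
below the selected one, and averaging over `|v|²`, which is `Γ(m)`-distributed, produces `selPdf`.
Ties have probability zero, so that the selection rule is immaterial. Finally, the fresh noise is
independent of the estimates, and given these the actual gain of port `n` is again a scaled
noncentral `χ²` variable, with the other Marcum `Q`-function as its tail.
-/

noncomputable section

namespace FluidAntenna

/-- The entire function `∑ v ^ k / (k! (k + ν)!)`, which is `I_ν` with its branch factor removed:
`I_ν(x) = (x / 2) ^ ν * besselSeries ν ((x / 2) ^ 2)`. -/
def besselSeries (ν : ℕ) (v : ℝ) : ℝ :=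
  ∑' k : ℕ, v ^ k / ((k.factorial : ℝ) * ((k + ν).factorial : ℝ))

lemma norm_besselSeries_term_le (ν k : ℕ) {v R : ℝ} (h : |v| ≤ R) :
    ‖v ^ k / ((k.factorial : ℝ) * ((k + ν).factorial : ℝ))‖ ≤ R ^ k / (k.factorial : ℝ) := by
  have h_one : (1 : ℝ) ≤ ((k + ν).factorial : ℝ) := by exact_mod_cast Nat.factorial_pos _
  rw [norm_div, norm_pow, Real.norm_eq_abs, Real.norm_of_nonneg (by positivity)]
  have hR : 0 ≤ R := (abs_nonneg _).trans h
  gcongr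
  exact le_mul_of_one_le_right (by positivity) h_one

lemma continuous_besselSeries (ν : ℕ) : Continuous (besselSeries ν) := by
  refine continuous_iff_continuousAt.2 fun v => ?_
  have h_ball : ContinuousOn (besselSeries ν) (Metric.ball 0 (|v| + 1)) :=
    continuousOn_tsum (fun k => by fun_prop) (Real.summable_pow_div_factorial (|v| + 1))
      fun k x hx => norm_besselSeries_term_le ν k (mem_ball_zero_iff.1 hx).le
  exact h_ball.continuousAt (Metric.isOpen_ball.mem_nhds (by simp))

lemma besselSeries_nonneg (ν : ℕ) {v : ℝ} (hv : 0 ≤ v) : 0 ≤ besselSeries ν v :=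
  tsum_nonneg fun k => by positivity

lemma besselSeries_zero (ν : ℕ) : besselSeries ν 0 = 1 / (ν.factorial : ℝ) := by
  rw [besselSeries, tsum_eq_single 0 (fun k hk => by simp [hk])]
  simp

lemma besselI_eq_pow_mul_besselSeries (ν : ℕ) (x : ℝ) :
    besselI ν x = (x / 2) ^ ν * besselSeries ν ((x / 2) ^ 2) := by
  rw [besselI, besselSeries, ← tsum_mul_left]
  congr 1 with k
  rw [pow_add, pow_mul]
  ring

/-- The density in `u > 0` of `∑ i, (v i + a i) ^ 2` for `2 (ν + 1)` independent `𝒩(0, 1/2)`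
variables `v i` and `w = ∑ i, a i ^ 2`: a noncentral chi-squared density, up to scaling. -/
def noncentralPDF (ν : ℕ) (w u : ℝ) : ℝ :=
  Real.exp (-(u + w)) * u ^ ν * besselSeries ν (w * u)

lemma continuous_noncentralPDF (ν : ℕ) :
    Continuous fun p : ℝ × ℝ => noncentralPDF ν p.1 p.2 := by
  have := continuous_besselSeries ν
  unfold noncentralPDF
  fun_prop

lemma measurable_noncentralPDF (ν : ℕ) (w : ℝ) : Measurable (noncentralPDF ν w) :=
  (continuous_noncentralPDF ν).measurable.comp measurable_prodMk_left

lemma noncentralPDF_nonneg (ν : ℕ) {w u : ℝ} (hw : 0 ≤ w) (hu : 0 ≤ u) :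
    0 ≤ noncentralPDF ν w u := by
  have := besselSeries_nonneg ν (mul_nonneg hw hu)
  unfold noncentralPDF
  positivity

lemma noncentralPDF_zero (ν : ℕ) (u : ℝ) :
    noncentralPDF ν 0 u = u ^ ν * Real.exp (-u) / ν.factorial := by
  rw [noncentralPDF, zero_mul, besselSeries_zero, add_zero]
  ring

section GammaIntegral

variable (n : ℕ) {r : ℂ}

lemma norm_pow_mul_cexp_neg_mul {x : ℝ} (hx : 0 ≤ x) :
    ‖(x : ℂ) ^ n * Complex.exp (-(r * x))‖ = x ^ n * Real.exp (-(r.re * x)) := by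
  rw [norm_mul, norm_pow, Complex.norm_exp, Complex.norm_real, Real.norm_of_nonneg hx,
    Complex.neg_re, Complex.re_mul_ofReal]

lemma integrableOn_pow_mul_cexp_neg_mul (hr : 0 < r.re) :
    IntegrableOn (fun x : ℝ => (x : ℂ) ^ n * Complex.exp (-(r * x))) (Ioi 0) := by
  have h_real : IntegrableOn (fun x : ℝ => x ^ n * Real.exp (-(r.re * x))) (Ioi 0) := by
    simpa using integrableOn_rpow_mul_exp_neg_mul_rpow (s := n) (p := 1)
      (by linarith [n.cast_nonneg (α := ℝ)]) one_pos hr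
  refine h_real.mono' (by fun_prop) ?_
  filter_upwards [ae_restrict_mem measurableSet_Ioi] with x hx
  exact (norm_pow_mul_cexp_neg_mul n (le_of_lt hx)).le

lemma tendsto_pow_mul_cexp_neg_mul_atTop (hr : 0 < r.re) :
    Filter.Tendsto (fun x : ℝ => (x : ℂ) ^ n * Complex.exp (-(r * x)))
      Filter.atTop (nhds 0) := by
  rw [tendsto_zero_iff_norm_tendsto_zero]
  refine (tendsto_rpow_mul_exp_neg_mul_atTop_nhds_zero n r.re hr).congr' ?_
  filter_upwards [Filter.eventually_ge_atTop 0] with x hx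
  rw [norm_pow_mul_cexp_neg_mul n hx, Real.rpow_natCast, neg_mul]

lemma hasDerivAt_pow_succ_mul_cexp_neg_mul (r : ℂ) (x : ℝ) :
    HasDerivAt (fun x : ℝ => (x : ℂ) ^ (n + 1) * Complex.exp (-(r * x)))
      ((n + 1) * ((x : ℂ) ^ n * Complex.exp (-(r * x)))
        - r * ((x : ℂ) ^ (n + 1) * Complex.exp (-(r * x)))) x := by
  have h_id : HasDerivAt (fun x : ℝ => (x : ℂ)) 1 x := Complex.ofRealCLM.hasDerivAt
  have h_pow : HasDerivAt (fun x : ℝ => (x : ℂ) ^ (n + 1)) ((n + 1) * (x : ℂ) ^ n) x :=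
    (h_id.pow (n + 1)).congr_deriv (by simp)
  have h_exp : HasDerivAt (fun x : ℝ => Complex.exp (-(r * x)))
      (Complex.exp (-(r * x)) * -(r * 1)) x := (h_id.const_mul r).neg.cexp
  exact (h_pow.mul h_exp).congr_deriv (by ring)

lemma mul_integral_pow_succ_mul_cexp_neg_mul (hr : 0 < r.re) :
    r * ∫ x in Ioi (0 : ℝ), (x : ℂ) ^ (n + 1) * Complex.exp (-(r * x))
      = (n + 1) * ∫ x in Ioi (0 : ℝ), (x : ℂ) ^ n * Complex.exp (-(r * x)) := by
  have h_int := (integrableOn_pow_mul_cexp_neg_mul n hr).const_mul (n + 1 : ℂ)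
  have h_int_succ := (integrableOn_pow_mul_cexp_neg_mul (n + 1) hr).const_mul r
  have h_parts := integral_Ioi_of_hasDerivAt_of_tendsto'
    (fun x _ => hasDerivAt_pow_succ_mul_cexp_neg_mul n r x) (h_int.sub h_int_succ)
    (tendsto_pow_mul_cexp_neg_mul_atTop (n + 1) hr)
  rw [integral_sub h_int h_int_succ, integral_const_mul, integral_const_mul, Complex.ofReal_zero,
    zero_pow n.succ_ne_zero, zero_mul, sub_zero] at h_parts
  exact (sub_eq_zero.1 h_parts).symm

lemma integral_pow_mul_cexp_neg_mul (hr : 0 < r.re) :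
    ∫ x in Ioi (0 : ℝ), (x : ℂ) ^ n * Complex.exp (-(r * x)) = n.factorial / r ^ (n + 1) := by
  have hr0 : r ≠ 0 := fun h => by simp [h] at hr
  induction n with
  | zero =>
    have h := integral_exp_mul_complex_Ioi (a := -r) (by simpa using hr) 0
    simpa [neg_mul] using h
  | succ n ih =>
    rw [← mul_right_inj' hr0, mul_integral_pow_succ_mul_cexp_neg_mul n hr, ih, Nat.factorial_succ]
    push_cast
    field_simp
    ring

lemma integral_pow_mul_exp_neg : ∫ x in Ioi (0 : ℝ), x ^ n * Real.exp (-x) = n.factorial := by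
  have h := integral_pow_mul_cexp_neg_mul n (r := 1) (by simp)
  rw [← Complex.ofReal_inj, ← integral_complex_ofReal]
  simpa using h

end GammaIntegral

/-- The `k`-th term of the series of `u ↦ exp (t u I) * noncentralPDF ν w u`, a multiple of the
integrand of a Gamma integral of complex rate `1 - t I`. -/
def charTerm (ν : ℕ) (w t : ℝ) (k : ℕ) (u : ℝ) : ℂ :=
  (Real.exp (-w) * w ^ k / (k.factorial * (k + ν).factorial) : ℝ)
    * ((u : ℂ) ^ (k + ν) * Complex.exp (-((1 - t * Complex.I) * u)))

section CharTerm

variable (ν : ℕ) {w : ℝ} (t : ℝ)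

lemma re_one_sub_ofReal_mul_I : (1 - t * Complex.I : ℂ).re = 1 := by simp

lemma one_sub_ofReal_mul_I_ne_zero : (1 - t * Complex.I : ℂ) ≠ 0 := fun h => by
  simpa [h] using re_one_sub_ofReal_mul_I t

lemma re_one_sub_ofReal_mul_I_pos : 0 < (1 - t * Complex.I : ℂ).re :=
  (re_one_sub_ofReal_mul_I t).symm ▸ one_pos

lemma tsum_charTerm (w u : ℝ) :
    ∑' k, charTerm ν w t k u = Complex.exp (t * u * Complex.I) * noncentralPDF ν w u := by
  have h_exp : Complex.exp (-((1 - t * Complex.I) * u))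
      = Complex.exp (t * u * Complex.I) * Complex.exp (-u) := by
    rw [← Complex.exp_add]
    ring_nf
  simp only [charTerm, noncentralPDF, besselSeries, h_exp]
  push_cast
  rw [← tsum_mul_left, ← tsum_mul_left]
  congr 1 with k
  rw [neg_add, Complex.exp_add, pow_add, mul_pow]
  ring

lemma integrableOn_charTerm (w : ℝ) (k : ℕ) : IntegrableOn (charTerm ν w t k) (Ioi 0) :=
  (integrableOn_pow_mul_cexp_neg_mul (k + ν) (re_one_sub_ofReal_mul_I_pos t)).const_mul _

lemma integral_norm_charTerm (hw : 0 ≤ w) (k : ℕ) :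
    ∫ u in Ioi (0 : ℝ), ‖charTerm ν w t k u‖ = Real.exp (-w) * (w ^ k / k.factorial) := by
  have h_norm : ∀ u ∈ Ioi (0 : ℝ), ‖charTerm ν w t k u‖
      = Real.exp (-w) * w ^ k / (k.factorial * (k + ν).factorial)
        * (u ^ (k + ν) * Real.exp (-u)) := by
    intro u hu
    rw [charTerm, norm_mul, norm_pow_mul_cexp_neg_mul _ (le_of_lt hu), re_one_sub_ofReal_mul_I,
      one_mul, Complex.norm_real, Real.norm_of_nonneg (by positivity)]
  rw [setIntegral_congr_fun measurableSet_Ioi h_norm, integral_const_mul, integral_pow_mul_exp_neg]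
  field_simp

lemma integral_charTerm (w : ℝ) (k : ℕ) :
    ∫ u in Ioi (0 : ℝ), charTerm ν w t k u
      = Complex.exp (-w) * (1 - t * Complex.I)⁻¹ ^ (ν + 1)
        * ((w / (1 - t * Complex.I)) ^ k / k.factorial) := by
  have hr := one_sub_ofReal_mul_I_ne_zero t
  simp only [charTerm]
  rw [integral_const_mul, integral_pow_mul_cexp_neg_mul _ (re_one_sub_ofReal_mul_I_pos t)]
  have h_fact : ((k + ν).factorial : ℂ) ≠ 0 := by exact_mod_cast Nat.factorial_ne_zero _
  push_cast
  generalize (1 - t * Complex.I : ℂ) = r at hr ⊢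
  rw [inv_pow, div_pow]
  field_simp
  ring

lemma integral_cexp_mul_noncentralPDF (hw : 0 ≤ w) :
    ∫ u in Ioi (0 : ℝ), Complex.exp (t * u * Complex.I) * noncentralPDF ν w u
      = (1 - t * Complex.I)⁻¹ ^ (ν + 1)
        * Complex.exp (w * (t * Complex.I) / (1 - t * Complex.I)) := by
  have h_summable : Summable fun k => ∫ u in Ioi (0 : ℝ), ‖charTerm ν w t k u‖ := by
    simp_rw [integral_norm_charTerm ν t hw]
    exact (Real.summable_pow_div_factorial w).mul_left _
  have h_series :=
    hasSum_integral_of_summable_integral_norm (integrableOn_charTerm ν t w) h_summable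
  simp_rw [tsum_charTerm, integral_charTerm] at h_series
  have h_exp := NormedSpace.expSeries_div_hasSum_exp (w / (1 - t * Complex.I))
  rw [← Complex.exp_eq_exp_ℂ] at h_exp
  rw [h_series.unique (h_exp.mul_left _), mul_comm (Complex.exp _), mul_assoc, ← Complex.exp_add]
  congr 2
  have hr := one_sub_ofReal_mul_I_ne_zero t
  field_simp
  ring

end CharTerm

lemma integral_noncentralPDF (ν : ℕ) {w : ℝ} (hw : 0 ≤ w) :
    ∫ u in Ioi (0 : ℝ), noncentralPDF ν w u = 1 := by
  have h := integral_cexp_mul_noncentralPDF ν 0 hw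
  rw [← Complex.ofReal_inj, ← integral_complex_ofReal]
  simpa using h

lemma integrableOn_noncentralPDF (ν : ℕ) {w : ℝ} (hw : 0 ≤ w) :
    IntegrableOn (noncentralPDF ν w) (Ioi 0) :=
  not_imp_comm.1 integral_undef (by rw [integral_noncentralPDF ν hw]; exact one_ne_zero)

/-- The law on the positive half-line with density `noncentralPDF ν w`. -/
def noncentralLaw (ν : ℕ) (w : ℝ) : Measure ℝ :=
  (volume.restrict (Ioi 0)).withDensity fun u => ENNReal.ofReal (noncentralPDF ν w u)

lemma isProbabilityMeasure_noncentralLaw (ν : ℕ) {w : ℝ} (hw : 0 ≤ w) :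
    IsProbabilityMeasure (noncentralLaw ν w) := by
  have h_nonneg : 0 ≤ᵐ[volume.restrict (Ioi 0)] noncentralPDF ν w := by
    filter_upwards [ae_restrict_mem measurableSet_Ioi] with u hu
    exact noncentralPDF_nonneg ν hw (le_of_lt hu)
  constructor
  rw [noncentralLaw, withDensity_apply _ MeasurableSet.univ, Measure.restrict_univ,
    ← ofReal_integral_eq_lintegral_ofReal (integrableOn_noncentralPDF ν hw) h_nonneg,
    integral_noncentralPDF ν hw, ENNReal.ofReal_one]

lemma charFun_noncentralLaw (ν : ℕ) {w : ℝ} (hw : 0 ≤ w) (t : ℝ) :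
    charFun (noncentralLaw ν w) t = (1 - t * Complex.I)⁻¹ ^ (ν + 1)
        * Complex.exp (w * (t * Complex.I) / (1 - t * Complex.I)) := by
  rw [charFun_apply_real, ← integral_cexp_mul_noncentralPDF ν t hw, noncentralLaw,
    integral_withDensity_eq_integral_toReal_smul (measurable_noncentralPDF ν w).ennreal_ofReal
      (by simp)]
  refine setIntegral_congr_fun measurableSet_Ioi fun u hu => ?_
  rw [ENNReal.toReal_ofReal (noncentralPDF_nonneg ν hw (le_of_lt hu)), Complex.real_smul, mul_comm]

lemma image_sq_div_two_Ioi {b : ℝ} (hb : 0 ≤ b) :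
    (fun t : ℝ => t ^ 2 / 2) '' Ioi b = Ioi (b ^ 2 / 2) := by
  ext u
  constructor
  · rintro ⟨t, ht : b < t, rfl⟩
    exact div_lt_div_of_pos_right (pow_lt_pow_left₀ ht hb two_ne_zero) two_pos
  · intro (hu : b ^ 2 / 2 < u)
    refine ⟨√(2 * u), Real.lt_sqrt_of_sq_lt (by linarith), ?_⟩
    have : 0 ≤ 2 * u := by linarith [sq_nonneg b]
    simp only [Real.sq_sqrt this, mul_div_cancel_left₀ u two_ne_zero]

lemma setIntegral_Ioi_sq_div_two {b : ℝ} (hb : 0 ≤ b) (g : ℝ → ℝ) :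
    ∫ u in Ioi (b ^ 2 / 2), g u = ∫ t in Ioi b, t * g (t ^ 2 / 2) := by
  have h_inj : InjOn (fun t : ℝ => t ^ 2 / 2) (Ioi b) := fun s hs t ht hst =>
    (pow_left_inj₀ (hb.trans (le_of_lt hs)) (hb.trans (le_of_lt ht)) two_ne_zero).1
      (by simpa using hst)
  have h_deriv : ∀ t ∈ Ioi b, HasDerivWithinAt (fun t : ℝ => t ^ 2 / 2) t (Ioi b) t := fun t _ =>
    ((hasDerivAt_pow 2 t).div_const 2).hasDerivWithinAt.congr_deriv (by simp)
  rw [← image_sq_div_two_Ioi hb,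
    integral_image_eq_integral_abs_deriv_smul measurableSet_Ioi h_deriv h_inj]
  refine setIntegral_congr_fun measurableSet_Ioi fun t ht => ?_
  simp only [smul_eq_mul, abs_of_pos (hb.trans_lt ht)]

lemma noncentralPDF_sq_div_two (ν : ℕ) {a : ℝ} (ha : a ≠ 0) (t : ℝ) :
    noncentralPDF ν (a ^ 2 / 2) (t ^ 2 / 2)
      = (t / a) ^ ν * Real.exp (-(t ^ 2 + a ^ 2) / 2) * besselI ν (a * t) := by
  have h_exp : -(t ^ 2 / 2 + a ^ 2 / 2) = -(t ^ 2 + a ^ 2) / 2 := by ring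
  have h_arg : a ^ 2 / 2 * (t ^ 2 / 2) = (a * t / 2) ^ 2 := by ring
  have h_pow : t ^ 2 / 2 = t / a * (a * t / 2) := by field_simp
  rw [noncentralPDF, besselI_eq_pow_mul_besselSeries, h_exp, h_arg, h_pow, mul_pow (t / a)]
  ring

lemma marcumQ_succ_eq_setIntegral_noncentralPDF (ν : ℕ) (a : ℝ) {b : ℝ} (hb : 0 ≤ b) :
    marcumQ (ν + 1) a b = ∫ u in Ioi (b ^ 2 / 2), noncentralPDF ν (a ^ 2 / 2) u := by
  rcases eq_or_ne a 0 with rfl | ha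
  · have h_zero : (0 : ℝ) ^ 2 / 2 = 0 := by norm_num
    rw [marcumQ, if_pos rfl, ← integral_div, h_zero]
    simp only [noncentralPDF_zero, Nat.cast_add_one, Real.Gamma_nat_eq_factorial,
      add_tsub_cancel_right]
  · rw [marcumQ, if_neg ha, setIntegral_Ioi_sq_div_two hb]
    simp only [noncentralPDF_sq_div_two ν ha, add_tsub_cancel_right, ← mul_assoc]

/-- The law of a vector of independent `𝒩(0, 1/2)` variables: the real and imaginary parts of a
standard complex Gaussian vector. -/
abbrev gaussVec (ι : Type*) [Fintype ι] : Measure (ι → ℝ) :=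
  Measure.pi fun _ : ι => gaussianReal 0 (1 / 2)

/-- `∫ exp (-(1 - t I) x²) dx / √π`, the characteristic function at `t` of the square of a
`𝒩(0, 1/2)` variable. -/
def gaussSqFactor (t : ℝ) : ℂ :=
  (√Real.pi : ℂ)⁻¹ * (Real.pi / (1 - t * Complex.I)) ^ (1 / 2 : ℂ)

lemma gaussSqFactor_sq (t : ℝ) : gaussSqFactor t ^ 2 = (1 - t * Complex.I)⁻¹ := by
  have h_pi : (Real.pi : ℂ) ≠ 0 := by exact_mod_cast Real.pi_ne_zero
  rw [gaussSqFactor, mul_pow, inv_pow, ← Complex.ofReal_pow, Real.sq_sqrt Real.pi_pos.le,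
    ← Complex.cpow_nat_mul, Nat.cast_ofNat, mul_one_div_cancel two_ne_zero, Complex.cpow_one]
  field_simp

lemma gaussianPDFReal_half_smul_cexp (t a x : ℝ) :
    gaussianPDFReal 0 (1 / 2) x • Complex.exp (t * ((x + a) ^ 2 : ℝ) * Complex.I)
      = (√Real.pi : ℂ)⁻¹ * Complex.exp (-(1 - t * Complex.I) * x ^ 2
        + (2 * t * a * Complex.I) * x + t * a ^ 2 * Complex.I) := by
  have h_var : 2 * Real.pi * ((1 / 2 : NNReal) : ℝ) = Real.pi := by
    push_cast
    ring
  rw [gaussianPDFReal, Complex.real_smul, h_var]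
  push_cast
  rw [mul_assoc, ← Complex.exp_add]
  congr 2
  ring

lemma integral_cexp_add_sq_gaussianReal (t a : ℝ) :
    ∫ x, Complex.exp (t * ((x + a) ^ 2 : ℝ) * Complex.I) ∂gaussianReal 0 (1 / 2)
      = gaussSqFactor t * Complex.exp ((a ^ 2 : ℝ) * (t * Complex.I) / (1 - t * Complex.I)) := by
  have hr := one_sub_ofReal_mul_I_ne_zero t
  rw [integral_gaussianReal_eq_integral_smul (by norm_num)]
  simp_rw [gaussianPDFReal_half_smul_cexp]
  rw [integral_const_mul, integral_cexp_quadratic (by simp), neg_neg, ← mul_assoc, gaussSqFactor]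
  congr 2
  push_cast
  field_simp
  ring_nf

section GaussVec

variable {ι : Type*} [Fintype ι]

lemma integral_cexp_sum_add_sq_gaussVec (t : ℝ) (a : ι → ℝ) :
    ∫ v, Complex.exp (t * (∑ i, (v i + a i) ^ 2 : ℝ) * Complex.I) ∂gaussVec ι
      = gaussSqFactor t ^ Fintype.card ι
        * Complex.exp ((∑ i, a i ^ 2 : ℝ) * (t * Complex.I) / (1 - t * Complex.I)) := by
  have h_prod (v : ι → ℝ) : Complex.exp (t * (∑ i, (v i + a i) ^ 2 : ℝ) * Complex.I)
      = ∏ i, Complex.exp (t * ((v i + a i) ^ 2 : ℝ) * Complex.I) := by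
    rw [← Complex.exp_sum, Complex.ofReal_sum, Finset.mul_sum, Finset.sum_mul]
  simp_rw [h_prod]
  rw [integral_fintype_prod_eq_prod
    (f := fun i x => Complex.exp (t * ((x + a i) ^ 2 : ℝ) * Complex.I))]
  simp_rw [integral_cexp_add_sq_gaussianReal]
  rw [Finset.prod_mul_distrib, Finset.prod_const, Finset.card_univ, ← Complex.exp_sum,
    Complex.ofReal_sum, Finset.sum_mul, Finset.sum_div]

variable {ν : ℕ}

lemma map_sum_add_sq_gaussVec (hι : Fintype.card ι = 2 * (ν + 1)) (a : ι → ℝ) :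
    (gaussVec ι).map (fun v => ∑ i, (v i + a i) ^ 2) = noncentralLaw ν (∑ i, a i ^ 2) := by
  have hw : 0 ≤ ∑ i, a i ^ 2 := by positivity
  have h_meas : Measurable fun v : ι → ℝ => ∑ i, (v i + a i) ^ 2 := by fun_prop
  have := isProbabilityMeasure_noncentralLaw ν hw
  have := Measure.isProbabilityMeasure_map (μ := gaussVec ι) h_meas.aemeasurable
  refine Measure.ext_of_charFun (funext fun t => ?_)
  rw [charFun_noncentralLaw ν hw, charFun_apply_real,
    integral_map h_meas.aemeasurable (by fun_prop), integral_cexp_sum_add_sq_gaussVec, hι,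
    pow_mul, gaussSqFactor_sq]

/-- The law of `∑ i, (√(1 - ρ²) v i + ρ w i) ^ 2` for a Gaussian vector `v` with `2 (ν + 1)` entries
and a fixed vector `w` with `∑ i, w i ^ 2 = z`. -/
def corrGainLaw (ν : ℕ) (ρ z : ℝ) : Measure ℝ :=
  (noncentralLaw ν (z * ρ ^ 2 / (1 - ρ ^ 2))).map ((1 - ρ ^ 2) * ·)

lemma one_sub_sq_pos {ρ : ℝ} (hρ : |ρ| < 1) : 0 < 1 - ρ ^ 2 :=
  sub_pos.2 ((sq_lt_one_iff_abs_lt_one ρ).2 hρ)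

lemma map_sum_sqrt_mul_add_sq_gaussVec (hι : Fintype.card ι = 2 * (ν + 1)) {ρ : ℝ}
    (hρ : |ρ| < 1) (w : ι → ℝ) :
    (gaussVec ι).map (fun v => ∑ i, (√(1 - ρ ^ 2) * v i + ρ * w i) ^ 2)
      = corrGainLaw ν ρ (∑ i, w i ^ 2) := by
  have hc := one_sub_sq_pos hρ
  have h_offset : ∑ i, (ρ * w i / √(1 - ρ ^ 2)) ^ 2 = (∑ i, w i ^ 2) * ρ ^ 2 / (1 - ρ ^ 2) := by
    simp_rw [div_pow, mul_pow, Real.sq_sqrt hc.le]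
    rw [← Finset.sum_div, ← Finset.mul_sum, mul_comm (ρ ^ 2)]
  have h_scale : (fun v : ι → ℝ => ∑ i, (√(1 - ρ ^ 2) * v i + ρ * w i) ^ 2)
      = ((1 - ρ ^ 2) * ·) ∘ fun v => ∑ i, (v i + ρ * w i / √(1 - ρ ^ 2)) ^ 2 := by
    ext v
    simp only [Function.comp_apply, Finset.mul_sum]
    refine Finset.sum_congr rfl fun i _ => ?_
    nth_rewrite 2 [← Real.sq_sqrt hc.le]
    rw [← mul_pow, mul_add, mul_div_cancel₀ _ (Real.sqrt_pos.2 hc).ne']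
  rw [h_scale, ← Measure.map_map (by fun_prop) (by fun_prop), map_sum_add_sq_gaussVec hι, h_offset,
    corrGainLaw]

end GaussVec

section CorrGainLaw

variable (ν : ℕ) {ρ z r : ℝ}

/-- The density in `x > 0` of `corrGainLaw ν ρ z`. -/
def corrGainPDF (ν : ℕ) (ρ z x : ℝ) : ℝ :=
  1 / (1 - ρ ^ 2) * noncentralPDF ν (z * ρ ^ 2 / (1 - ρ ^ 2)) (x / (1 - ρ ^ 2))

lemma continuous_corrGainPDF (ρ : ℝ) :
    Continuous fun p : ℝ × ℝ => corrGainPDF ν ρ p.1 p.2 :=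
  continuous_const.mul ((continuous_noncentralPDF ν).comp
    (f := fun p : ℝ × ℝ => (p.1 * ρ ^ 2 / (1 - ρ ^ 2), p.2 / (1 - ρ ^ 2))) (by fun_prop))

lemma corrGainPDF_nonneg {x : ℝ} (hρ : |ρ| < 1) (hz : 0 ≤ z) (hx : 0 ≤ x) :
    0 ≤ corrGainPDF ν ρ z x := by
  have hc := one_sub_sq_pos hρ
  exact mul_nonneg (by positivity) (noncentralPDF_nonneg ν (by positivity) (by positivity))

lemma corrGainLaw_eq_withDensity (hρ : |ρ| < 1) (z : ℝ) :
    corrGainLaw ν ρ z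
      = (volume.restrict (Ioi 0)).withDensity fun x => ENNReal.ofReal (corrGainPDF ν ρ z x) := by
  have hc := one_sub_sq_pos hρ
  have h_meas : Measurable fun u : ℝ => (1 - ρ ^ 2) * u := by fun_prop
  have h_image : (fun u => (1 - ρ ^ 2) * u) '' Ioi 0 = Ioi 0 := by
    rw [image_mul_left_Ioi hc, mul_zero]
  ext s hs
  rw [corrGainLaw, Measure.map_apply h_meas hs, noncentralLaw, withDensity_apply _ (h_meas hs),
    withDensity_apply _ hs, Measure.restrict_restrict hs, Measure.restrict_restrict (h_meas hs)]
  conv_rhs => rw [← h_image, ← image_preimage_inter]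
  rw [lintegral_image_eq_lintegral_abs_deriv_mul (f' := fun _ => 1 - ρ ^ 2)
    ((h_meas hs).inter measurableSet_Ioi)
    (fun u _ => by simpa using ((hasDerivAt_id u).const_mul (1 - ρ ^ 2)).hasDerivWithinAt)
    (mul_right_injective₀ hc.ne').injOn]
  refine lintegral_congr fun u => ?_
  rw [corrGainPDF, abs_of_pos hc, ← ENNReal.ofReal_mul hc.le, ← mul_assoc,
    mul_one_div_cancel hc.ne', one_mul, mul_div_cancel_left₀ _ hc.ne']

lemma nullSingletonClass_corrGainLaw (hρ : |ρ| < 1) (z : ℝ) :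
    NullSingletonClass (corrGainLaw ν ρ z) := by
  rw [corrGainLaw_eq_withDensity ν hρ]
  exact nullSingletonClass_withDensity _

lemma isProbabilityMeasure_corrGainLaw (hρ : |ρ| < 1) (hz : 0 ≤ z) :
    IsProbabilityMeasure (corrGainLaw ν ρ z) := by
  have hc := one_sub_sq_pos hρ
  have := isProbabilityMeasure_noncentralLaw ν (w := z * ρ ^ 2 / (1 - ρ ^ 2)) (by positivity)
  exact Measure.isProbabilityMeasure_map (by fun_prop)

lemma marcumQ_succ_nonneg (a : ℝ) {b : ℝ} (hb : 0 ≤ b) : 0 ≤ marcumQ (ν + 1) a b := by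
  rw [marcumQ_succ_eq_setIntegral_noncentralPDF ν a hb]
  refine setIntegral_nonneg measurableSet_Ioi fun u (hu : b ^ 2 / 2 < u) => ?_
  exact noncentralPDF_nonneg ν (by positivity) ((by positivity : 0 ≤ b ^ 2 / 2).trans hu.le)

lemma marcumQ_succ_le_one (a : ℝ) {b : ℝ} (hb : 0 ≤ b) : marcumQ (ν + 1) a b ≤ 1 := by
  have hw : 0 ≤ a ^ 2 / 2 := by positivity
  rw [marcumQ_succ_eq_setIntegral_noncentralPDF ν a hb, ← integral_noncentralPDF ν hw]
  refine setIntegral_mono_set (integrableOn_noncentralPDF ν hw) ?_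
    (Ioi_subset_Ioi (by positivity)).eventuallyLE
  filter_upwards [ae_restrict_mem measurableSet_Ioi] with u hu
  exact noncentralPDF_nonneg ν hw (le_of_lt hu)

lemma noncentralLaw_Ioi {w : ℝ} (hw : 0 ≤ w) (hr : 0 ≤ r) :
    noncentralLaw ν w (Ioi r) = ENNReal.ofReal (marcumQ (ν + 1) √(2 * w) √(2 * r)) := by
  have h_nonneg : 0 ≤ᵐ[volume.restrict (Ioi r)] noncentralPDF ν w := by
    filter_upwards [ae_restrict_mem measurableSet_Ioi] with u hu
    exact noncentralPDF_nonneg ν hw (hr.trans (le_of_lt hu))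
  have h_int := (integrableOn_noncentralPDF ν hw).mono_set (Ioi_subset_Ioi hr)
  rw [marcumQ_succ_eq_setIntegral_noncentralPDF ν _ (Real.sqrt_nonneg _),
    Real.sq_sqrt (by positivity), Real.sq_sqrt (by positivity),
    mul_div_cancel_left₀ _ two_ne_zero, mul_div_cancel_left₀ _ two_ne_zero,
    ofReal_integral_eq_lintegral_ofReal h_int h_nonneg, noncentralLaw,
    withDensity_apply _ measurableSet_Ioi, Measure.restrict_restrict measurableSet_Ioi,
    Ioi_inter_Ioi, max_eq_left hr]

lemma corrGainLaw_Ioi (hρ : |ρ| < 1) (hz : 0 ≤ z) (hr : 0 ≤ r) :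
    corrGainLaw ν ρ z (Ioi r) = ENNReal.ofReal
      (marcumQ (ν + 1) √(2 * z * ρ ^ 2 / (1 - ρ ^ 2)) √(2 * r / (1 - ρ ^ 2))) := by
  have hc := one_sub_sq_pos hρ
  rw [corrGainLaw, Measure.map_apply (by fun_prop) measurableSet_Ioi,
    preimage_const_mul_Ioi₀ _ hc, noncentralLaw_Ioi ν (by positivity) (by positivity),
    mul_div_assoc', mul_div_assoc', mul_assoc]

lemma corrGainLaw_Iic (hρ : |ρ| < 1) (hz : 0 ≤ z) (hr : 0 ≤ r) :
    corrGainLaw ν ρ z (Iic r) = ENNReal.ofReal (phi (ν + 1) ρ z r) := by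
  have := isProbabilityMeasure_corrGainLaw ν hρ hz
  rw [← compl_Ioi, prob_compl_eq_one_sub measurableSet_Ioi, corrGainLaw_Ioi ν hρ hz hr, phi,
    ENNReal.ofReal_sub _ (marcumQ_succ_nonneg ν _ (Real.sqrt_nonneg _)), ENNReal.ofReal_one]

lemma phi_succ_nonneg (ρ z x : ℝ) : 0 ≤ phi (ν + 1) ρ z x :=
  sub_nonneg.2 (marcumQ_succ_le_one ν _ (Real.sqrt_nonneg _))

lemma phi_succ_le_one (ρ z x : ℝ) : phi (ν + 1) ρ z x ≤ 1 :=
  sub_le_self _ (marcumQ_succ_nonneg ν _ (Real.sqrt_nonneg _))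

lemma measurable_marcumQ_succ_sqrt {α : Type*} [MeasurableSpace α] {f g : α → ℝ}
    (hf : Measurable f) (hg : Measurable g) :
    Measurable fun p => marcumQ (ν + 1) √(f p) √(g p) := by
  have h_integral (p : α) : marcumQ (ν + 1) √(f p) √(g p)
      = ∫ u, {q : α × ℝ | √(g q.1) ^ 2 / 2 < q.2}.indicator
          (fun q => noncentralPDF ν (√(f q.1) ^ 2 / 2) q.2) (p, u) := by
    rw [marcumQ_succ_eq_setIntegral_noncentralPDF ν _ (Real.sqrt_nonneg _),
      ← integral_indicator measurableSet_Ioi]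
    rfl
  simp_rw [h_integral]
  refine (StronglyMeasurable.integral_prod_right' (Measurable.stronglyMeasurable ?_)).measurable
  refine Measurable.indicator ?_ (measurableSet_lt (by fun_prop) (by fun_prop))
  exact (continuous_noncentralPDF ν).measurable.comp
    (f := fun q : α × ℝ => (√(f q.1) ^ 2 / 2, q.2)) (by fun_prop)

lemma measurable_phi_succ (ρ : ℝ) : Measurable fun p : ℝ × ℝ => phi (ν + 1) ρ p.1 p.2 :=
  measurable_const.sub (measurable_marcumQ_succ_sqrt ν (by fun_prop) (by fun_prop))

end CorrGainLaw

section SelPdf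

variable (ν : ℕ)

lemma besselFactor_succ_eq (ρ : ℝ) {x z : ℝ} (hxz : 0 ≤ x * z) :
    besselFactor (ν + 1) ρ x z = (x * z / (1 - ρ ^ 2)) ^ ν
      * besselSeries ν (z * ρ ^ 2 / (1 - ρ ^ 2) * (x / (1 - ρ ^ 2))) := by
  rcases eq_or_ne ρ 0 with rfl | hρ
  · rw [besselFactor, if_pos rfl, Nat.cast_add_one, Real.Gamma_nat_eq_factorial]
    norm_num [besselSeries_zero, div_eq_mul_inv]
  have h_rpow : (x * z / ρ ^ 2) ^ (((ν + 1 : ℕ) - 1 : ℝ) / 2) = √(x * z / ρ ^ 2) ^ ν := by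
    rw [Real.sqrt_eq_rpow, ← Real.rpow_natCast _ ν, ← Real.rpow_mul (by positivity)]
    push_cast
    ring_nf
  have h_half : 2 * √(x * z * ρ ^ 2) / (1 - ρ ^ 2) / 2 = √(x * z * ρ ^ 2) / (1 - ρ ^ 2) := by ring
  have h_sqrt : √(x * z / ρ ^ 2) * √(x * z * ρ ^ 2) = x * z := by
    have h_sq : x * z / ρ ^ 2 * (x * z * ρ ^ 2) = (x * z) ^ 2 := by field_simp
    rw [← Real.sqrt_mul (by positivity), h_sq, Real.sqrt_sq hxz]
  have h_arg : x * z * ρ ^ 2 / (1 - ρ ^ 2) ^ 2 = z * ρ ^ 2 / (1 - ρ ^ 2) * (x / (1 - ρ ^ 2)) := by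
    rw [div_mul_div_comm, sq (1 - ρ ^ 2)]
    ring
  rw [besselFactor, if_neg hρ, h_rpow, add_tsub_cancel_right, besselI_eq_pow_mul_besselSeries,
    h_half, ← mul_assoc, ← mul_pow, ← mul_div_assoc, h_sqrt, div_pow √_,
    Real.sq_sqrt (by positivity), h_arg]

lemma mul_exp_mul_besselFactor_succ {ρ x z : ℝ} (hρ : |ρ| < 1) (hxz : 0 ≤ x * z) :
    1 / (Real.Gamma (ν + 1 : ℕ) * (1 - ρ ^ 2))
        * (Real.exp (-((x + z) / (1 - ρ ^ 2))) * besselFactor (ν + 1) ρ x z)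
      = noncentralPDF ν 0 z * corrGainPDF ν ρ z x := by
  have hc := (one_sub_sq_pos hρ).ne'
  have h_exp : Real.exp (-((x + z) / (1 - ρ ^ 2)))
      = Real.exp (-z) * Real.exp (-(x / (1 - ρ ^ 2) + z * ρ ^ 2 / (1 - ρ ^ 2))) := by
    rw [← Real.exp_add]
    congr 1
    field_simp
    ring
  have h_pow : (x * z / (1 - ρ ^ 2)) ^ ν = z ^ ν * (x / (1 - ρ ^ 2)) ^ ν := by
    rw [mul_comm x, mul_div_assoc, mul_pow]
  rw [besselFactor_succ_eq ν ρ hxz, noncentralPDF_zero, corrGainPDF, noncentralPDF, h_exp, h_pow,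
    Nat.cast_add_one, Real.Gamma_nat_eq_factorial]
  field_simp

variable {N : ℕ} [NeZero N] (ρ : Fin N → ℝ) (n : Fin N)

/-- The conditional probability that the gains of all ports other than `0` and `n` are at most `x`,
given that port `0` has gain `z`. -/
def othersBelow (ν : ℕ) (ρ : Fin N → ℝ) (n : Fin N) (z x : ℝ) : ℝ :=
  ∏ k ∈ (Finset.univ.erase (0 : Fin N)).erase n, phi (ν + 1) (ρ k) z x

lemma othersBelow_nonneg (z x : ℝ) : 0 ≤ othersBelow ν ρ n z x :=
  Finset.prod_nonneg fun k _ => phi_succ_nonneg ν (ρ k) z x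

lemma othersBelow_le_one (z x : ℝ) : othersBelow ν ρ n z x ≤ 1 :=
  Finset.prod_le_one (fun k _ => phi_succ_nonneg ν (ρ k) z x) fun k _ => phi_succ_le_one ν (ρ k) z x

lemma measurable_othersBelow : Measurable fun p : ℝ × ℝ => othersBelow ν ρ n p.1 p.2 :=
  Finset.measurable_prod _ fun k _ => measurable_phi_succ ν (ρ k)

lemma selPdf_succ_zero (x : ℝ) :
    selPdf (ν + 1) ρ 0 x = noncentralPDF ν 0 x * othersBelow ν ρ 0 x x := by
  rw [selPdf, if_pos rfl, othersBelow, Finset.erase_idem, noncentralPDF_zero, Nat.cast_add_one,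
    Real.Gamma_nat_eq_factorial, add_tsub_cancel_right]
  ring

/-- The density at `x`, given that port `0` has gain `z`, of the gain of port `n ≠ 0` on the event
that port `n` has the largest gain. -/
def condSelPDF (ν : ℕ) (ρ : Fin N → ℝ) (n : Fin N) (z x : ℝ) : ℝ :=
  if z ≤ x then corrGainPDF ν (ρ n) z x * othersBelow ν ρ n z x else 0

lemma measurable_condSelPDF : Measurable fun p : ℝ × ℝ => condSelPDF ν ρ n p.1 p.2 :=
  Measurable.ite (measurableSet_le measurable_fst measurable_snd)
    ((continuous_corrGainPDF ν (ρ n)).measurable.mul (measurable_othersBelow ν ρ n))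
    measurable_const

variable {n}

lemma condSelPDF_nonneg (hρ : |ρ n| < 1) {z x : ℝ} (hz : 0 ≤ z) (hx : 0 ≤ x) :
    0 ≤ condSelPDF ν ρ n z x :=
  ite_nonneg (mul_nonneg (corrGainPDF_nonneg ν hρ hz hx) (othersBelow_nonneg ν ρ n z x)) le_rfl

variable (n) in
lemma noncentralPDF_mul_condSelPDF (x : ℝ) :
    (fun z => noncentralPDF ν 0 z * condSelPDF ν ρ n z x) = (Iic x).indicator
      fun z => noncentralPDF ν 0 z * corrGainPDF ν (ρ n) z x * othersBelow ν ρ n z x := by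
  ext z
  simp only [condSelPDF, mul_ite, mul_zero, indicator_apply, mem_Iic, mul_assoc]

variable (n) in
lemma integrableOn_noncentralPDF_mul_condSelPDF (x : ℝ) :
    IntegrableOn (fun z => noncentralPDF ν 0 z * condSelPDF ν ρ n z x) (Ioi 0) := by
  have h_cont : Continuous fun z : ℝ => noncentralPDF ν 0 z * corrGainPDF ν (ρ n) z x :=
    ((continuous_noncentralPDF ν).comp (f := fun z : ℝ => ((0 : ℝ), z)) (by fun_prop)).mul
      ((continuous_corrGainPDF ν (ρ n)).comp (f := fun z : ℝ => (z, x)) (by fun_prop))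
  have h_int : IntegrableOn (fun z : ℝ => noncentralPDF ν 0 z * corrGainPDF ν (ρ n) z x)
      (Ioc 0 x) := h_cont.integrableOn_Ioc
  have h_meas : Measurable fun z => othersBelow ν ρ n z x :=
    (measurable_othersBelow ν ρ n).comp (f := fun z : ℝ => (z, x)) (by fun_prop)
  rw [noncentralPDF_mul_condSelPDF, IntegrableOn, integrable_indicator_iff measurableSet_Iic,
    IntegrableOn, Measure.restrict_restrict measurableSet_Iic, inter_comm, Ioi_inter_Iic]
  refine h_int.mul_bdd (c := 1) h_meas.aestronglyMeasurable (ae_of_all _ fun z => ?_)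
  rw [Real.norm_of_nonneg (othersBelow_nonneg ν ρ n z x)]
  exact othersBelow_le_one ν ρ n z x

lemma selPdf_succ_of_ne_zero (hn : n ≠ 0) (hρ : |ρ n| < 1) {x : ℝ} (hx : 0 ≤ x) :
    selPdf (ν + 1) ρ n x = ∫ z in Ioi 0, noncentralPDF ν 0 z * condSelPDF ν ρ n z x := by
  rw [noncentralPDF_mul_condSelPDF, setIntegral_indicator measurableSet_Iic, Ioi_inter_Iic, selPdf,
    if_neg hn, intervalIntegral.integral_of_le hx, ← integral_const_mul]
  refine setIntegral_congr_fun measurableSet_Ioc fun z hz => ?_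
  simp only [← mul_exp_mul_besselFactor_succ ν hρ (mul_nonneg hx hz.1.le), othersBelow]
  ring

lemma ofReal_selPdf_succ_of_ne_zero (hn : n ≠ 0) (hρ : |ρ n| < 1) {x : ℝ} (hx : 0 ≤ x) :
    ENNReal.ofReal (selPdf (ν + 1) ρ n x) = ∫⁻ z in Ioi 0,
      ENNReal.ofReal (noncentralPDF ν 0 z) * ENNReal.ofReal (condSelPDF ν ρ n z x) := by
  have h_nonneg : 0 ≤ᵐ[volume.restrict (Ioi 0)] fun z =>
      noncentralPDF ν 0 z * condSelPDF ν ρ n z x := by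
    filter_upwards [ae_restrict_mem measurableSet_Ioi] with z hz
    exact mul_nonneg (noncentralPDF_nonneg ν le_rfl (le_of_lt hz))
      (condSelPDF_nonneg ν ρ hρ (le_of_lt hz) hx)
  rw [selPdf_succ_of_ne_zero ν ρ hn hρ hx, ofReal_integral_eq_lintegral_ofReal
    (integrableOn_noncentralPDF_mul_condSelPDF ν ρ n x) h_nonneg]
  refine setLIntegral_congr_fun measurableSet_Ioi fun z hz => ?_
  exact ENNReal.ofReal_mul (noncentralPDF_nonneg ν le_rfl (le_of_lt hz))

variable {ρ}

lemma selPdf_succ_nonneg (hρ : ∀ n, n ≠ 0 → |ρ n| < 1) (n : Fin N) {x : ℝ} (hx : 0 ≤ x) :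
    0 ≤ selPdf (ν + 1) ρ n x := by
  rcases eq_or_ne n 0 with rfl | hn
  · rw [selPdf_succ_zero]
    exact mul_nonneg (noncentralPDF_nonneg ν le_rfl hx) (othersBelow_nonneg ν ρ 0 x x)
  · rw [selPdf_succ_of_ne_zero ν ρ hn (hρ n hn) hx]
    exact setIntegral_nonneg measurableSet_Ioi fun z hz =>
      mul_nonneg (noncentralPDF_nonneg ν le_rfl (le_of_lt hz))
        (condSelPDF_nonneg ν ρ (hρ n hn) (le_of_lt hz) hx)

lemma aemeasurable_selPdf_succ (hρ : ∀ n, n ≠ 0 → |ρ n| < 1) (n : Fin N) :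
    AEMeasurable (selPdf (ν + 1) ρ n) (volume.restrict (Ioi 0)) := by
  rcases eq_or_ne n 0 with rfl | hn
  · refine Measurable.aemeasurable ?_
    rw [funext (selPdf_succ_zero ν ρ)]
    exact (measurable_noncentralPDF ν 0).mul
      ((measurable_othersBelow ν ρ 0).comp (f := fun x : ℝ => (x, x)) (by fun_prop))
  · have h_meas : Measurable fun p : ℝ × ℝ => noncentralPDF ν 0 p.2 * condSelPDF ν ρ n p.2 p.1 :=
      ((measurable_noncentralPDF ν 0).comp measurable_snd).mul
        ((measurable_condSelPDF ν ρ n).comp measurable_swap)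
    refine ⟨_, (h_meas.stronglyMeasurable.integral_prod_right'
      (ν := volume.restrict (Ioi 0))).measurable, ?_⟩
    filter_upwards [ae_restrict_mem measurableSet_Ioi] with x hx
    exact selPdf_succ_of_ne_zero ν ρ hn (hρ n hn) (le_of_lt hx)

end SelPdf

section ProductMeasure

variable {ι : Type*} [Fintype ι] [DecidableEq ι]

lemma map_update_prod_pi {X : ι → Type*} [∀ i, MeasurableSpace (X i)] (μ : ∀ i, Measure (X i))
    [∀ i, SigmaFinite (μ i)] (n : ι) [IsProbabilityMeasure (μ n)] :
    ((μ n).prod (Measure.pi μ)).map (fun p => Function.update p.2 n p.1) = Measure.pi μ := by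
  have h_meas : Measurable fun p : X n × (∀ i, X i) => Function.update p.2 n p.1 := by fun_prop
  refine (Measure.pi_eq fun s hs => ?_).symm
  have h_preimage : (fun p : X n × (∀ i, X i) => Function.update p.2 n p.1) ⁻¹' univ.pi s
      = s n ×ˢ univ.pi (Function.update s n univ) := by
    ext p
    simp only [mem_preimage, mem_pi, mem_univ, true_imp_iff, mem_prod]
    rw [Function.forall_update_iff p.2 fun i y => y ∈ s i,
      Function.forall_update_iff s fun i t => p.2 i ∈ t]
    simp only [mem_univ, true_and]
  rw [Measure.map_apply h_meas (.univ_pi hs), h_preimage, Measure.prod_prod, Measure.pi_pi,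
    ← Finset.mul_prod_erase _ _ (Finset.mem_univ n), Function.update_self, measure_univ, one_mul,
    ← Finset.mul_prod_erase _ _ (Finset.mem_univ n)]
  congr 1
  refine Finset.prod_congr rfl fun i hi => ?_
  rw [Function.update_of_ne (Finset.ne_of_mem_erase hi)]

lemma pi_apply_eq_lintegral_update {X : ι → Type*} [∀ i, MeasurableSpace (X i)]
    (μ : ∀ i, Measure (X i)) [∀ i, SigmaFinite (μ i)] (n : ι) [IsProbabilityMeasure (μ n)]
    {S : Set (∀ i, X i)} (hS : MeasurableSet S) :
    Measure.pi μ S = ∫⁻ x, Measure.pi μ {g | Function.update g n x ∈ S} ∂μ n := by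
  have h_meas : Measurable fun p : X n × (∀ i, X i) => Function.update p.2 n p.1 := by fun_prop
  conv_lhs => rw [← map_update_prod_pi μ n, Measure.map_apply h_meas hS,
    Measure.prod_apply (h_meas hS)]
  rfl

lemma measurableSet_setOf_mem_and_forall_le {ι : Type*} [Countable ι] (n : ι) {A : Set ℝ}
    (hA : MeasurableSet A) : MeasurableSet {g : ι → ℝ | g n ∈ A ∧ ∀ k, g k ≤ g n} :=
  (measurable_pi_apply n hA).inter (measurableSet_setOfPred.2 (Measurable.forall fun k =>
    (measurableSet_le (measurable_pi_apply k) (measurable_pi_apply n)).mem))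

variable (μ : ι → Measure ℝ) [∀ i, IsProbabilityMeasure (μ i)]

omit [DecidableEq ι] in
lemma pi_setOf_apply_eq_apply {i j : ι} [NullSingletonClass (μ i)] (hij : i ≠ j) :
    Measure.pi μ {g | g i = g j} = 0 := by
  classical
  rw [pi_apply_eq_lintegral_update μ j
    (measurableSet_eq_fun (measurable_pi_apply i) (measurable_pi_apply j))]
  refine lintegral_eq_zero_of_ae_eq_zero (ae_of_all _ fun x => ?_)
  simp only [mem_ofPred_eq, Function.update_self, Function.update_of_ne hij]
  exact Measure.pi_hyperplane μ i x

lemma pi_setOf_mem_and_forall_le (n : ι) {A : Set ℝ} (hA : MeasurableSet A) :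
    Measure.pi μ {g | g n ∈ A ∧ ∀ k, g k ≤ g n}
      = ∫⁻ x in A, ∏ k ∈ Finset.univ.erase n, μ k (Iic x) ∂μ n := by
  rw [pi_apply_eq_lintegral_update μ n (measurableSet_setOf_mem_and_forall_le n hA),
    ← lintegral_indicator hA]
  refine lintegral_congr fun x => ?_
  simp only [mem_ofPred_eq, Function.update_self]
  by_cases hx : x ∈ A
  · have h_fibre : {g : ι → ℝ | x ∈ A ∧ ∀ k, Function.update g n x k ≤ x}
        = univ.pi (Function.update (fun _ => Iic x) n univ) := by
      ext g
      simp only [hx, true_and, mem_ofPred_eq, mem_univ_pi]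
      rw [Function.forall_update_iff g fun _ y => y ≤ x,
        Function.forall_update_iff (fun _ => Iic x) fun k t => g k ∈ t]
      simp only [le_refl, true_and, mem_univ, mem_Iic]
    rw [indicator_of_mem hx, h_fibre, Measure.pi_pi,
      ← Finset.mul_prod_erase _ _ (Finset.mem_univ n), Function.update_self, measure_univ, one_mul]
    refine Finset.prod_congr rfl fun k hk => ?_
    rw [Function.update_of_ne (Finset.ne_of_mem_erase hk)]
  · simp only [hx, false_and, ofPred_false, measure_empty, not_false_eq_true, indicator_of_notMem]

end ProductMeasure

section GainLaw

variable {N : ℕ} [NeZero N] (ν : ℕ) {ρ : Fin N → ℝ} {z : ℝ}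

/-- The conditional law of the gain of port `k`, given that port `0` has gain `z`. -/
def gainLaw (ν : ℕ) (ρ : Fin N → ℝ) (z : ℝ) (k : Fin N) : Measure ℝ :=
  if k = 0 then Measure.dirac z else corrGainLaw ν (ρ k) z

variable (ρ z) in
lemma gainLaw_zero : gainLaw ν ρ z 0 = Measure.dirac z := if_pos rfl

variable (ρ z) in
lemma gainLaw_of_ne_zero {k : Fin N} (hk : k ≠ 0) : gainLaw ν ρ z k = corrGainLaw ν (ρ k) z :=
  if_neg hk

lemma isProbabilityMeasure_gainLaw (hρ : ∀ k, k ≠ 0 → |ρ k| < 1) (hz : 0 ≤ z) (k : Fin N) :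
    IsProbabilityMeasure (gainLaw ν ρ z k) := by
  rcases eq_or_ne k 0 with rfl | hk
  · rw [gainLaw_zero]
    infer_instance
  · rw [gainLaw_of_ne_zero ν ρ z hk]
    exact isProbabilityMeasure_corrGainLaw ν (hρ k hk) hz

lemma prod_gainLaw_Iic (hρ : ∀ k, k ≠ 0 → |ρ k| < 1) (hz : 0 ≤ z) (n : Fin N) {x : ℝ}
    (hx : 0 ≤ x) :
    ∏ k ∈ (Finset.univ.erase (0 : Fin N)).erase n, gainLaw ν ρ z k (Iic x)
      = ENNReal.ofReal (othersBelow ν ρ n z x) := by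
  rw [othersBelow, ENNReal.ofReal_prod_of_nonneg fun k _ => phi_succ_nonneg ν (ρ k) z x]
  refine Finset.prod_congr rfl fun k hk => ?_
  have hk₀ : k ≠ 0 := Finset.ne_of_mem_erase (Finset.mem_of_mem_erase hk)
  rw [gainLaw_of_ne_zero ν ρ z hk₀, corrGainLaw_Iic ν (hρ k hk₀) hz hx]

lemma pi_gainLaw_setOf_apply_eq_apply (hρ : ∀ k, k ≠ 0 → |ρ k| < 1) (hz : 0 ≤ z) {j n : Fin N}
    (hjn : j ≠ n) : Measure.pi (gainLaw ν ρ z) {g | g j = g n} = 0 := by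
  have := isProbabilityMeasure_gainLaw ν hρ hz
  wlog hj : j ≠ 0 generalizing j n
  · rw [not_not] at hj
    have h_symm : {g : Fin N → ℝ | g j = g n} = {g | g n = g j} := by
      ext g
      exact eq_comm
    rw [h_symm]
    exact this hjn.symm (hj ▸ hjn.symm)
  have : NullSingletonClass (gainLaw ν ρ z j) := by
    rw [gainLaw_of_ne_zero ν ρ z hj]
    exact nullSingletonClass_corrGainLaw ν (hρ j hj) z
  exact pi_setOf_apply_eq_apply _ hjn

lemma pi_gainLaw_zero_mem_and_forall_le (hρ : ∀ k, k ≠ 0 → |ρ k| < 1) (hz : 0 ≤ z) {A : Set ℝ}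
    (hA : MeasurableSet A) :
    Measure.pi (gainLaw ν ρ z) {g | g 0 ∈ A ∧ ∀ k, g k ≤ g 0}
      = A.indicator (fun x => ENNReal.ofReal (othersBelow ν ρ 0 x x)) z := by
  have := isProbabilityMeasure_gainLaw ν hρ hz
  classical
  rw [pi_setOf_mem_and_forall_le _ _ hA, gainLaw_zero, setLIntegral_dirac, indicator_apply,
    ← prod_gainLaw_Iic ν hρ hz 0 hz, Finset.erase_idem]

lemma pi_gainLaw_mem_and_forall_le {n : Fin N} (hn : n ≠ 0) (hρ : ∀ k, k ≠ 0 → |ρ k| < 1)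
    (hz : 0 ≤ z) {A : Set ℝ} (hA : MeasurableSet A) :
    Measure.pi (gainLaw ν ρ z) {g | g n ∈ A ∧ ∀ k, g k ≤ g n}
      = ∫⁻ x in A, ENNReal.ofReal (condSelPDF ν ρ n z x) ∂volume.restrict (Ioi 0) := by
  have := isProbabilityMeasure_gainLaw ν hρ hz
  have h_mem : (0 : Fin N) ∈ Finset.univ.erase n := Finset.mem_erase.2 ⟨hn.symm, Finset.mem_univ _⟩
  have h_meas : Measurable fun x => ENNReal.ofReal (corrGainPDF ν (ρ n) z x) :=
    ((continuous_corrGainPDF ν (ρ n)).comp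
      (f := fun x : ℝ => (z, x)) (by fun_prop)).measurable.ennreal_ofReal
  rw [pi_setOf_mem_and_forall_le _ _ hA, gainLaw_of_ne_zero ν ρ z hn,
    corrGainLaw_eq_withDensity ν (hρ n hn),
    setLIntegral_withDensity_eq_setLIntegral_mul_non_measurable _ h_meas _ hA
    (ae_of_all _ fun x => ENNReal.ofReal_lt_top)]
  refine setLIntegral_congr_fun hA fun x _ => ?_
  simp only [Pi.mul_apply, condSelPDF]
  rw [← Finset.mul_prod_erase _ _ h_mem, Finset.erase_right_comm, gainLaw_zero]
  split_ifs with hzx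
  · rw [prod_gainLaw_Iic ν hρ hz n (hz.trans hzx), Measure.dirac_apply' _ measurableSet_Iic,
      indicator_of_mem (mem_Iic.2 hzx), Pi.one_apply, one_mul,
      ENNReal.ofReal_mul' (othersBelow_nonneg ν ρ n z x)]
  · rw [Measure.dirac_apply' _ measurableSet_Iic, indicator_of_notMem (by simpa using hzx),
      zero_mul, mul_zero, ENNReal.ofReal_zero]

end GainLaw

section VecGain

variable {N : ℕ} [NeZero N] {ι : Type*}

/-- The real and imaginary parts of the estimated channels of port `n`, where `u` and `v` are the
Gaussian vectors of ports `0` and `n`. -/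
def estVec (ρ : Fin N → ℝ) (n : Fin N) (u v : ι → ℝ) : ι → ℝ :=
  if n = 0 then u else fun i => √(1 - ρ n ^ 2) * v i + ρ n * u i

variable (ρ : Fin N → ℝ)

lemma estVec_zero (u v : ι → ℝ) : estVec ρ 0 u v = u := if_pos rfl

lemma estVec_of_ne_zero {n : Fin N} (hn : n ≠ 0) (u v : ι → ℝ) :
    estVec ρ n u v = fun i => √(1 - ρ n ^ 2) * v i + ρ n * u i := if_neg hn

lemma measurable_estVec (n : Fin N) :
    Measurable fun p : (ι → ℝ) × (ι → ℝ) => estVec ρ n p.1 p.2 := by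
  unfold estVec
  split_ifs <;> fun_prop

variable [Fintype ι] (n : Fin N)

/-- The estimated gain of port `n`, where `w k` is the Gaussian vector of port `k`. -/
def vecGain (ρ : Fin N → ℝ) (w : Fin N → ι → ℝ) (n : Fin N) : ℝ :=
  ∑ i, estVec ρ n (w 0) (w n) i ^ 2

lemma measurable_vecGain : Measurable fun w : Fin N → ι → ℝ => vecGain ρ w n := by
  have h_est : Measurable fun w : Fin N → ι → ℝ => estVec ρ n (w 0) (w n) :=
    (measurable_estVec ρ n).comp (f := fun w : Fin N → ι → ℝ => (w 0, w n)) (by fun_prop)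
  unfold vecGain
  fun_prop

/-- The actual gain of port `n`, where `w k` is the Gaussian vector of port `k` and `v` the fresh
one of port `n`. -/
def outdatedVecGain (ρ : Fin N → ℝ) (μ : ℝ) (w : Fin N → ι → ℝ) (v : ι → ℝ) (n : Fin N) : ℝ :=
  ∑ i, (√(1 - μ ^ 2) * v i + μ * estVec ρ n (w 0) (w n) i) ^ 2

lemma measurable_outdatedVecGain (μ : ℝ) :
    Measurable fun p : (Fin N → ι → ℝ) × (ι → ℝ) => outdatedVecGain ρ μ p.1 p.2 n := by
  have h_est : Measurable fun p : (Fin N → ι → ℝ) × (ι → ℝ) => estVec ρ n (p.1 0) (p.1 n) :=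
    (measurable_estVec ρ n).comp
      (f := fun p : (Fin N → ι → ℝ) × (ι → ℝ) => (p.1 0, p.1 n)) (by fun_prop)
  unfold outdatedVecGain
  fun_prop

lemma measurableSet_mem_and_lt_outdatedVecGain {B : Set (Fin N → ι → ℝ)} (hB : MeasurableSet B)
    (μ r : ℝ) : MeasurableSet {p : (Fin N → ι → ℝ) × (ι → ℝ) |
      p.1 ∈ B ∧ r < outdatedVecGain ρ μ p.1 p.2 n} :=
  (measurable_fst hB).inter (measurable_outdatedVecGain ρ n μ measurableSet_Ioi)

/-- The event that port `n` has the largest estimated gain. -/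
def maxEvent (ι : Type*) [Fintype ι] (ρ : Fin N → ℝ) (n : Fin N) : Set (Fin N → ι → ℝ) :=
  {w | ∀ k, vecGain ρ w k ≤ vecGain ρ w n}

lemma measurableSet_maxEvent : MeasurableSet (maxEvent ι ρ n) :=
  measurableSet_setOfPred.2 (Measurable.forall fun k =>
    (measurableSet_le (measurable_vecGain ρ k) (measurable_vecGain ρ n)).mem)

end VecGain

section CanonicalModel

variable {N : ℕ} [NeZero N] {ι : Type*} [Fintype ι] {ν : ℕ} (hι : Fintype.card ι = 2 * (ν + 1))
  {ρ : Fin N → ℝ} (hρ : ∀ k, k ≠ 0 → |ρ k| < 1)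

include hι

lemma lintegral_sum_sq_gaussVec {F : ℝ → ENNReal} (hF : Measurable F) :
    ∫⁻ v, F (∑ i, v i ^ 2) ∂gaussVec ι
      = ∫⁻ z in Ioi 0, ENNReal.ofReal (noncentralPDF ν 0 z) * F z := by
  have h_map : (gaussVec ι).map (fun v => ∑ i, v i ^ 2) = noncentralLaw ν 0 := by
    simpa using map_sum_add_sq_gaussVec hι 0
  rw [← lintegral_map (f := F) hF (by fun_prop), h_map, noncentralLaw,
    lintegral_withDensity_eq_lintegral_mul _ (measurable_noncentralPDF ν 0).ennreal_ofReal hF]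
  rfl

include hρ

lemma map_vecGain_update_zero (v : ι → ℝ) :
    (Measure.pi fun _ : Fin N => gaussVec ι).map (fun w => vecGain ρ (Function.update w 0 v))
      = Measure.pi (gainLaw ν ρ (∑ i, v i ^ 2)) := by
  let f (k : Fin N) (u : ι → ℝ) : ℝ := ∑ i, estVec ρ k v u i ^ 2
  have h_gain : (fun w : Fin N → ι → ℝ => vecGain ρ (Function.update w 0 v))
      = fun w k => f k (w k) := by
    ext w k
    rcases eq_or_ne k 0 with rfl | hk
    · simp only [f, vecGain, estVec_zero, Function.update_self]
    · simp only [f, vecGain, Function.update_self, Function.update_of_ne hk]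
  have h_law (k : Fin N) : (gaussVec ι).map (f k) = gainLaw ν ρ (∑ i, v i ^ 2) k := by
    rcases eq_or_ne k 0 with rfl | hk
    · simp only [f, estVec_zero, gainLaw_zero, Measure.map_const, measure_univ, one_smul]
    · simp only [f, estVec_of_ne_zero ρ hk, gainLaw_of_ne_zero ν ρ _ hk]
      exact map_sum_sqrt_mul_add_sq_gaussVec hι (hρ k hk) v
  have h_meas (k : Fin N) : Measurable (f k) := by
    have h_est : Measurable fun u : ι → ℝ => estVec ρ k v u :=
      (measurable_estVec ρ k).comp (f := fun u : ι → ℝ => (v, u)) (by fun_prop)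
    fun_prop
  have (k : Fin N) := Measure.isProbabilityMeasure_map (μ := gaussVec ι) (h_meas k).aemeasurable
  rw [h_gain, Measure.pi_map_pi fun k => (h_meas k).aemeasurable]
  simp_rw [h_law]

lemma pi_gaussVec_vecGain_mem {S : Set (Fin N → ℝ)} (hS : MeasurableSet S) :
    Measure.pi (fun _ => gaussVec ι) {w | vecGain ρ w ∈ S}
      = ∫⁻ v, Measure.pi (gainLaw ν ρ (∑ i, v i ^ 2)) S ∂gaussVec ι := by
  have h_gain : Measurable fun w : Fin N → ι → ℝ => vecGain ρ w :=
    measurable_pi_lambda _ (measurable_vecGain ρ)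
  have h_set : MeasurableSet {w : Fin N → ι → ℝ | vecGain ρ w ∈ S} := h_gain hS
  rw [pi_apply_eq_lintegral_update _ 0 h_set]
  refine lintegral_congr fun v => ?_
  have h_meas : Measurable fun w : Fin N → ι → ℝ => vecGain ρ (Function.update w 0 v) :=
    h_gain.comp (by fun_prop)
  rw [← map_vecGain_update_zero hι hρ v, Measure.map_apply h_meas hS]
  rfl

lemma pi_gaussVec_vecGain_eq_vecGain {j n : Fin N} (hjn : j ≠ n) :
    Measure.pi (fun _ => gaussVec ι) {w | vecGain ρ w j = vecGain ρ w n} = 0 := by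
  have h_ties : MeasurableSet {g : Fin N → ℝ | g j = g n} :=
    measurableSet_eq_fun (measurable_pi_apply j) (measurable_pi_apply n)
  refine (pi_gaussVec_vecGain_mem hι hρ h_ties).trans ?_
  refine lintegral_eq_zero_of_ae_eq_zero (ae_of_all _ fun v => ?_)
  exact pi_gainLaw_setOf_apply_eq_apply ν hρ (by positivity) hjn

lemma pi_gaussVec_vecGain_mem_inter_maxEvent (n : Fin N) {A : Set ℝ} (hA : MeasurableSet A) :
    Measure.pi (fun _ => gaussVec ι) ((fun w => vecGain ρ w n) ⁻¹' A ∩ maxEvent ι ρ n)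
      = ∫⁻ x in A, ENNReal.ofReal (selPdf (ν + 1) ρ n x) ∂volume.restrict (Ioi 0) := by
  have h_set : MeasurableSet {g : Fin N → ℝ | g n ∈ A ∧ ∀ k, g k ≤ g n} :=
    measurableSet_setOf_mem_and_forall_le n hA
  refine (pi_gaussVec_vecGain_mem hι hρ h_set).trans ?_
  rcases eq_or_ne n 0 with rfl | hn
  · have h_meas : Measurable fun x => ENNReal.ofReal (othersBelow ν ρ 0 x x) :=
      ((measurable_othersBelow ν ρ 0).comp (f := fun x : ℝ => (x, x)) (by fun_prop)).ennreal_ofReal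
    rw [lintegral_congr fun v : ι → ℝ =>
        pi_gainLaw_zero_mem_and_forall_le ν hρ (by positivity : 0 ≤ ∑ i, v i ^ 2) hA,
      lintegral_sum_sq_gaussVec hι (h_meas.indicator hA), ← lintegral_indicator hA]
    refine setLIntegral_congr_fun measurableSet_Ioi fun x hx => ?_
    by_cases hxA : x ∈ A
    · simp only [indicator_of_mem hxA, selPdf_succ_zero,
        ENNReal.ofReal_mul (noncentralPDF_nonneg ν le_rfl (le_of_lt hx))]
    · simp only [indicator_of_notMem hxA, mul_zero]
  · have h_meas : Measurable fun p : ℝ × ℝ => ENNReal.ofReal (condSelPDF ν ρ n p.1 p.2) :=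
      (measurable_condSelPDF ν ρ n).ennreal_ofReal
    have h_pdf : Measurable fun p : ℝ × ℝ => ENNReal.ofReal (noncentralPDF ν 0 p.1) :=
      ((measurable_noncentralPDF ν 0).comp measurable_fst).ennreal_ofReal
    rw [lintegral_congr fun v : ι → ℝ =>
        pi_gainLaw_mem_and_forall_le ν hn hρ (by positivity : 0 ≤ ∑ i, v i ^ 2) hA,
      lintegral_sum_sq_gaussVec hι (h_meas.lintegral_prod_right')]
    simp_rw [← lintegral_const_mul' _ _ ENNReal.ofReal_ne_top]
    rw [lintegral_lintegral_swap (h_pdf.mul h_meas).aemeasurable]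
    refine lintegral_congr_ae (ae_restrict_of_ae ?_)
    filter_upwards [ae_restrict_mem measurableSet_Ioi] with x hx
    exact (ofReal_selPdf_succ_of_ne_zero ν ρ hn (hρ n hn) (le_of_lt hx)).symm

lemma map_vecGain_restrict_maxEvent (n : Fin N) :
    ((Measure.pi fun _ => gaussVec ι).restrict (maxEvent ι ρ n)).map (fun w => vecGain ρ w n)
      = (volume.restrict (Ioi 0)).withDensity
          fun t => ENNReal.ofReal (selPdf (ν + 1) ρ n t) := by
  have h_meas : Measurable fun w : Fin N → ι → ℝ => vecGain ρ w n := measurable_vecGain ρ n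
  ext A hA
  rw [Measure.map_apply h_meas hA, Measure.restrict_apply (h_meas hA), withDensity_apply _ hA,
    pi_gaussVec_vecGain_mem_inter_maxEvent hι hρ n hA]

omit hρ

lemma prod_gaussVec_mem_and_lt (n : Fin N) {μ : ℝ} (hμ : |μ| < 1) {r : ℝ} (hr : 0 ≤ r)
    {B : Set (Fin N → ι → ℝ)} (hB : MeasurableSet B) :
    ((Measure.pi fun _ => gaussVec ι).prod (gaussVec ι))
        {p | p.1 ∈ B ∧ r < outdatedVecGain ρ μ p.1 p.2 n}
      = ∫⁻ w in B, ENNReal.ofReal (marcumQ (ν + 1)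
          √(2 * vecGain ρ w n * μ ^ 2 / (1 - μ ^ 2)) √(2 * r / (1 - μ ^ 2)))
          ∂Measure.pi fun _ => gaussVec ι := by
  rw [Measure.prod_apply (measurableSet_mem_and_lt_outdatedVecGain ρ n hB μ r),
    ← lintegral_indicator hB]
  refine lintegral_congr fun w => ?_
  by_cases hw : w ∈ B
  · rw [indicator_of_mem hw, vecGain, ← corrGainLaw_Ioi ν hμ (by positivity) hr,
      ← map_sum_sqrt_mul_add_sq_gaussVec hι hμ, Measure.map_apply (by fun_prop) measurableSet_Ioi]
    simp only [preimage_ofPred_eq, hw, true_and]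
    rfl
  · simp only [indicator_of_notMem hw, preimage_ofPred_eq, hw, false_and, ofPred_false,
      measure_empty]

include hρ

lemma prod_gaussVec_maxEvent_and_lt (n : Fin N) {μ : ℝ} (hμ : |μ| < 1) {r : ℝ} (hr : 0 ≤ r) :
    ((Measure.pi fun _ => gaussVec ι).prod (gaussVec ι))
        {p | p.1 ∈ maxEvent ι ρ n ∧ r < outdatedVecGain ρ μ p.1 p.2 n}
      = ∫⁻ t in Ioi 0, ENNReal.ofReal (marcumQ (ν + 1) √(2 * t * μ ^ 2 / (1 - μ ^ 2))
          √(2 * r / (1 - μ ^ 2)) * selPdf (ν + 1) ρ n t) := by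
  have h_meas : Measurable fun t => ENNReal.ofReal (marcumQ (ν + 1)
      √(2 * t * μ ^ 2 / (1 - μ ^ 2)) √(2 * r / (1 - μ ^ 2))) :=
    (measurable_marcumQ_succ_sqrt ν (by fun_prop) (by fun_prop)).ennreal_ofReal
  rw [prod_gaussVec_mem_and_lt hι n hμ hr (measurableSet_maxEvent ρ n),
    ← lintegral_map (f := fun t => ENNReal.ofReal (marcumQ (ν + 1)
      √(2 * t * μ ^ 2 / (1 - μ ^ 2)) √(2 * r / (1 - μ ^ 2)))) h_meas
      (measurable_vecGain ρ n),
    map_vecGain_restrict_maxEvent hι hρ n, lintegral_withDensity_eq_lintegral_mul₀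
      (aemeasurable_selPdf_succ ν hρ n).ennreal_ofReal h_meas.aemeasurable]
  refine lintegral_congr fun t => ?_
  rw [Pi.mul_apply, mul_comm, ENNReal.ofReal_mul (marcumQ_succ_nonneg ν _ (Real.sqrt_nonneg _))]

end CanonicalModel

lemma iIndepFun_curry {Ω ι κ E : Type*} [MeasurableSpace Ω] {P : Measure Ω} [Countable ι]
    [Countable κ] [MeasurableSpace E] {Y : ι × κ → Ω → E} (hY : ∀ p, AEMeasurable (Y p) P)
    (h : iIndepFun Y P) : iIndepFun (fun i ω j => Y (i, j) ω) P := by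
  have := h.isProbabilityMeasure
  have (p : ι × κ) : IsProbabilityMeasure (P.map (Y p)) :=
    Measure.isProbabilityMeasure_map (hY p)
  have h_row_law (i : ι) : P.map (fun ω j => Y (i, j) ω)
      = Measure.infinitePi fun j => P.map (Y (i, j)) :=
    (h.precomp (Prod.mk_right_injective i)).map_fun_eq_infinitePi_map₀' fun j => hY (i, j)
  rw [iIndepFun_iff_map_fun_eq_infinitePi_map₀' fun i =>
    aemeasurable_pi_lambda _ fun j => hY (i, j)]
  simp_rw [h_row_law]
  rw [← Measure.infinitePi_map_curry (fun i j => P.map (Y (i, j))),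
    ← h.map_fun_eq_infinitePi_map₀' hY,
    AEMeasurable.map_map_of_aemeasurable (by fun_prop) (aemeasurable_pi_lambda _ hY)]
  rfl

section Model

variable {Ω : Type*} {N m : ℕ} (xh yh x y : Fin N → Fin m → Ω → ℝ)

/-- The Gaussian vectors of the model, with the `2 m` real and imaginary parts of a port as
coordinates: `(0, n)` indexes the one behind the estimate of port `n`, `(1, n)` the fresh one. -/
def portVec (i : Fin 2 × Fin N) (ω : Ω) (j : Fin 2 × Fin m) : ℝ :=
  ![xh, yh, x, y] (finProdFinEquiv (i.1, j.1)) i.2 j.2 ω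

/-- The Gaussian vectors behind the estimates of all the ports. -/
def estPortVec (ω : Ω) (n : Fin N) : Fin 2 × Fin m → ℝ := portVec xh yh x y (0, n) ω

variable {xh yh x y}

lemma estChannel_eq_estVec [NeZero N] (ρ : Fin N → ℝ) (n : Fin N) (k : Fin m) (ω : Ω) :
    estChannel ρ xh yh n k ω
      = estVec ρ n (estPortVec xh yh x y ω 0) (estPortVec xh yh x y ω n) (0, k)
        + estVec ρ n (estPortVec xh yh x y ω 0) (estPortVec xh yh x y ω n) (1, k)
          * Complex.I := by
  unfold estChannel estVec
  split_ifs <;> rw [mul_comm Complex.I] <;> rfl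

lemma estGain_eq_vecGain [NeZero N] (ρ : Fin N → ℝ) (n : Fin N) (ω : Ω) :
    estGain ρ xh yh n ω = vecGain ρ (estPortVec xh yh x y ω) n := by
  simp only [estGain, vecGain, Fintype.sum_prod_type, Fin.sum_univ_two, ← Finset.sum_add_distrib]
  refine Finset.sum_congr rfl fun k _ => ?_
  rw [estChannel_eq_estVec (x := x) (y := y), Complex.sq_norm, Complex.normSq_add_mul_I]

lemma outdatedGain_eq_outdatedVecGain [NeZero N] (ρ μ : Fin N → ℝ) (n : Fin N) (ω : Ω) :
    outdatedGain ρ μ xh yh x y n ω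
      = outdatedVecGain ρ (μ n) (estPortVec xh yh x y ω) (portVec xh yh x y (1, n) ω) n := by
  have h_re (k : Fin m) : portVec xh yh x y (1, n) ω (0, k) = x n k ω := rfl
  have h_im (k : Fin m) : portVec xh yh x y (1, n) ω (1, k) = y n k ω := rfl
  simp only [outdatedGain, outdatedVecGain, Fintype.sum_prod_type, Fin.sum_univ_two,
    ← Finset.sum_add_distrib]
  refine Finset.sum_congr rfl fun k _ => ?_
  rw [← Complex.normSq_add_mul_I, ← Complex.sq_norm, outdatedChannel,
    estChannel_eq_estVec (x := x) (y := y), h_re, h_im]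
  congr 2
  push_cast
  ring

variable [MeasurableSpace Ω] {P : Measure Ω}

lemma IsGaussianModel.hasLaw_portVec_apply (hG : IsGaussianModel P xh yh x y) (i : Fin 2 × Fin N)
    (j : Fin 2 × Fin m) :
    HasLaw (fun ω => portVec xh yh x y i ω j) (gaussianReal 0 (1 / 2)) P := by
  have h_entry (a : Fin 4) (n : Fin N) (k : Fin m) :
      HasLaw (![xh, yh, x, y] a n k) (gaussianReal 0 (1 / 2)) P := by
    fin_cases a
    exacts [hG.law_xh n k, hG.law_yh n k, hG.law_x n k, hG.law_y n k]
  exact h_entry _ i.2 j.2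

lemma IsGaussianModel.iIndepFun_portVec_apply (hG : IsGaussianModel P xh yh x y) :
    iIndepFun (fun (p : (Fin 2 × Fin N) × (Fin 2 × Fin m)) ω => portVec xh yh x y p.1 ω p.2) P :=
  have h_inj : Function.Injective fun p : (Fin 2 × Fin N) × (Fin 2 × Fin m) =>
      (finProdFinEquiv (p.1.1, p.2.1), p.1.2, p.2.2) :=
    ((Equiv.prodProdProdComm _ _ _ _).trans
      (finProdFinEquiv.prodCongr (Equiv.refl (Fin N × Fin m)))).injective
  hG.indep.precomp h_inj

lemma IsGaussianModel.iIndepFun_portVec (hG : IsGaussianModel P xh yh x y) :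
    iIndepFun (portVec xh yh x y) P :=
  iIndepFun_curry (Y := fun p ω => portVec xh yh x y p.1 ω p.2)
    (fun p => (hG.hasLaw_portVec_apply p.1 p.2).aemeasurable) hG.iIndepFun_portVec_apply

lemma IsGaussianModel.hasLaw_portVec (hG : IsGaussianModel P xh yh x y) (i : Fin 2 × Fin N) :
    HasLaw (portVec xh yh x y i) (gaussVec (Fin 2 × Fin m)) P :=
  iIndepFun.hasLaw_pi (hG.hasLaw_portVec_apply i)
    (hG.iIndepFun_portVec_apply.precomp (Prod.mk_right_injective i))

lemma IsGaussianModel.hasLaw_estPortVec (hG : IsGaussianModel P xh yh x y) :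
    HasLaw (estPortVec xh yh x y) (Measure.pi fun _ => gaussVec (Fin 2 × Fin m)) P :=
  iIndepFun.hasLaw_pi (fun n => hG.hasLaw_portVec (0, n))
    (hG.iIndepFun_portVec.precomp (Prod.mk_right_injective 0))

lemma IsGaussianModel.indepFun_estPortVec_portVec (hG : IsGaussianModel P xh yh x y)
    (n : Fin N) : IndepFun (estPortVec xh yh x y) (portVec xh yh x y (1, n)) P := by
  classical
  let S : Finset (Fin 2 × Fin N) := Finset.univ.filter fun i => i.1 = 0
  let T : Finset (Fin 2 × Fin N) := {(1, n)}
  have hST : Disjoint S T := by simp [S, T]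
  have h_indep :=
    hG.iIndepFun_portVec.indepFun_finset₀ S T hST fun i => (hG.hasLaw_portVec i).aemeasurable
  exact h_indep.comp
    (φ := fun (u : S → Fin 2 × Fin m → ℝ) (k : Fin N) => u ⟨(0, k), by simp [S]⟩)
    (ψ := fun (u : T → Fin 2 × Fin m → ℝ) => u ⟨(1, n), by simp [T]⟩) (by fun_prop) (by fun_prop)

lemma IsGaussianModel.hasLaw_estPortVec_prodMk_portVec (hG : IsGaussianModel P xh yh x y)
    (n : Fin N) :
    HasLaw (fun ω => (estPortVec xh yh x y ω, portVec xh yh x y (1, n) ω))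
      ((Measure.pi fun _ => gaussVec (Fin 2 × Fin m)).prod (gaussVec (Fin 2 × Fin m))) P :=
  have := hG.indep.isProbabilityMeasure
  (hG.indepFun_estPortVec_portVec n).hasLaw_prod hG.hasLaw_estPortVec (hG.hasLaw_portVec (1, n))

end Model

section Selection

variable {Ω : Type*} [MeasurableSpace Ω] {P : Measure Ω} {N : ℕ} {s : Ω → Fin N}

lemma aemeasurable_apply_selected (hs : Measurable s) {g : Fin N → Ω → ℝ}
    (hg : ∀ n, AEMeasurable (g n) P) : AEMeasurable (fun ω => g (s ω) ω) P := by
  have h_sum : (fun ω => g (s ω) ω) = fun ω => ∑ n, {ω | s ω = n}.indicator (g n) ω := by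
    ext ω
    simp only [indicator_apply, mem_ofPred_eq, Finset.sum_ite_eq, Finset.mem_univ, if_true]
  rw [h_sum]
  exact Finset.aemeasurable_fun_sum _ fun n _ => (hg n).indicator (hs (measurableSet_singleton n))

lemma measureReal_lt_apply_selected [IsFiniteMeasure P] (hs : Measurable s) {g : Fin N → Ω → ℝ}
    (hg : ∀ n, AEMeasurable (g n) P) (r : ℝ) :
    P.real {ω | r < g (s ω) ω} = ∑ n, P.real ({ω | s ω = n} ∩ {ω | r < g n ω}) := by
  have h_union : {ω | r < g (s ω) ω} = ⋃ n, ({ω | s ω = n} ∩ {ω | r < g n ω}) := by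
    ext ω
    simp
  rw [h_union, measureReal_def, measure_iUnion₀, tsum_fintype,
    ENNReal.toReal_sum fun n _ => measure_ne_top P _]
  · rfl
  · exact fun i j hij => Disjoint.aedisjoint
      (disjoint_left.2 fun ω hi hj => hij (hi.1.symm.trans hj.1))
  · exact fun n => (hs (measurableSet_singleton n)).nullMeasurableSet.inter
      ((hg n).nullMeasurableSet_preimage measurableSet_Ioi)

lemma cdf_map_apply_selected [IsProbabilityMeasure P] (hs : Measurable s) {g : Fin N → Ω → ℝ}
    (hg : ∀ n, AEMeasurable (g n) P) (r : ℝ) :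
    cdf (P.map fun ω => g (s ω) ω) r
      = 1 - ∑ n, P.real ({ω | s ω = n} ∩ {ω | r < g n ω}) := by
  have h_meas := aemeasurable_apply_selected hs hg
  have := Measure.isProbabilityMeasure_map h_meas
  have h_compl : (fun ω => g (s ω) ω) ⁻¹' Iic r = {ω | r < g (s ω) ω}ᶜ := by
    ext ω
    simp
  have h_null : NullMeasurableSet {ω | r < g (s ω) ω} P :=
    h_meas.nullMeasurableSet_preimage measurableSet_Ioi
  rw [cdf_eq_real, map_measureReal_apply_of_aemeasurable h_meas measurableSet_Iic, h_compl,
    probReal_compl_eq_one_sub₀ h_null, measureReal_lt_apply_selected hs hg]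

end Selection

section Port

variable {Ω : Type*} [MeasurableSpace Ω] {P : Measure Ω} {N m ν : ℕ} [NeZero N]
  {ρ : Fin N → ℝ} {s : Ω → Fin N}

lemma IsGaussianModel.aemeasurable_outdatedGain {xh yh x y : Fin N → Fin m → Ω → ℝ}
    (hG : IsGaussianModel P xh yh x y) (μ : Fin N → ℝ) (n : Fin N) :
    AEMeasurable (outdatedGain ρ μ xh yh x y n) P := by
  rw [funext (outdatedGain_eq_outdatedVecGain ρ μ n)]
  exact (measurable_outdatedVecGain ρ n (μ n)).comp_aemeasurable
    (f := fun ω => (estPortVec xh yh x y ω, portVec xh yh x y (1, n) ω))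
    (hG.hasLaw_estPortVec_prodMk_portVec n).aemeasurable

variable {xh yh x y : Fin N → Fin (ν + 1) → Ω → ℝ} (hG : IsGaussianModel P xh yh x y)
  (hρ : ∀ n, n ≠ 0 → |ρ n| < 1)
  (hmax : ∀ ω n, estGain ρ xh yh n ω ≤ estGain ρ xh yh (s ω) ω) (n : Fin N)

lemma ae_marcumQ_mul_selPdf_nonneg (hρ : ∀ n, n ≠ 0 → |ρ n| < 1) (n : Fin N) (a : ℝ → ℝ)
    {b : ℝ} (hb : 0 ≤ b) :
    0 ≤ᵐ[volume.restrict (Ioi 0)] fun t => marcumQ (ν + 1) (a t) b * selPdf (ν + 1) ρ n t := by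
  filter_upwards [ae_restrict_mem measurableSet_Ioi] with t ht
  exact mul_nonneg (marcumQ_succ_nonneg ν _ hb) (selPdf_succ_nonneg ν hρ n (le_of_lt ht))

lemma card_fin_two_prod (m : ℕ) : Fintype.card (Fin 2 × Fin m) = 2 * m := by simp

include hG hρ

lemma IsGaussianModel.ae_estGain_ne {j : Fin N} (hjn : j ≠ n) :
    ∀ᵐ ω ∂P, estGain ρ xh yh j ω ≠ estGain ρ xh yh n ω := by
  have h_ties : MeasurableSet {w : Fin N → Fin 2 × Fin (ν + 1) → ℝ |
      vecGain ρ w j = vecGain ρ w n} :=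
    measurableSet_eq_fun (measurable_vecGain ρ j) (measurable_vecGain ρ n)
  simp only [ae_iff, not_not, estGain_eq_vecGain (x := x) (y := y)]
  rw [hG.hasLaw_estPortVec.measure_eq h_ties]
  exact pi_gaussVec_vecGain_eq_vecGain (card_fin_two_prod _) hρ hjn

include hmax

lemma IsGaussianModel.setOf_eq_ae_eq_maxEvent :
    {ω | s ω = n} =ᵐ[P] estPortVec xh yh x y ⁻¹' maxEvent (Fin 2 × Fin (ν + 1)) ρ n := by
  have h_ties : ∀ᵐ ω ∂P, ∀ j, j ≠ n → estGain ρ xh yh j ω ≠ estGain ρ xh yh n ω :=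
    ae_all_iff.2 fun j => Filter.eventually_imp_distrib_left.2 (hG.ae_estGain_ne hρ n)
  filter_upwards [h_ties] with ω hω
  refine propext (?_ : s ω = n ↔
    ∀ k, vecGain ρ (estPortVec xh yh x y ω) k ≤ vecGain ρ (estPortVec xh yh x y ω) n)
  simp only [← estGain_eq_vecGain]
  constructor
  · rintro rfl k
    exact hmax ω k
  · intro h_le
    by_contra h_ne
    exact hω (s ω) h_ne ((h_le (s ω)).antisymm (hmax ω n))

lemma IsGaussianModel.map_estGain_restrict :
    (P.restrict {ω | s ω = n}).map (estGain ρ xh yh n)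
      = (volume.restrict (Ioi 0)).withDensity
          fun t => ENNReal.ofReal (selPdf (ν + 1) ρ n t) := by
  have h_law := hG.hasLaw_estPortVec
  have h_gain : estGain ρ xh yh n = (fun w => vecGain ρ w n) ∘ estPortVec xh yh x y :=
    funext (estGain_eq_vecGain ρ n)
  rw [Measure.restrict_congr_set (hG.setOf_eq_ae_eq_maxEvent hρ hmax n), h_gain,
    ← AEMeasurable.map_map_of_aemeasurable (measurable_vecGain ρ n).aemeasurable
      h_law.aemeasurable.restrict,
    ← Measure.restrict_map_of_aemeasurable h_law.aemeasurable (measurableSet_maxEvent ρ n),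
    h_law.map_eq, map_vecGain_restrict_maxEvent (card_fin_two_prod _) hρ n]

variable {μ : Fin N → ℝ} (hμ : |μ n| < 1) {r : ℝ} (hr : 0 ≤ r)

include hμ hr

lemma IsGaussianModel.measure_selected_inter_lt :
    P ({ω | s ω = n} ∩ {ω | r < outdatedGain ρ μ xh yh x y n ω})
      = ∫⁻ t in Ioi 0, ENNReal.ofReal
          (marcumQ (ν + 1) √(2 * t * μ n ^ 2 / (1 - μ n ^ 2)) √(2 * r / (1 - μ n ^ 2))
            * selPdf (ν + 1) ρ n t) := by
  refine (measure_congr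
    ((hG.setOf_eq_ae_eq_maxEvent hρ hmax n).inter (ae_eq_refl _))).trans ?_
  simp only [outdatedGain_eq_outdatedVecGain]
  refine ((hG.hasLaw_estPortVec_prodMk_portVec n).measure_eq
    (measurableSet_mem_and_lt_outdatedVecGain ρ n (measurableSet_maxEvent ρ n) (μ n) r)).trans ?_
  exact prod_gaussVec_maxEvent_and_lt (card_fin_two_prod _) hρ n hμ hr

lemma IsGaussianModel.integrableOn_marcumQ_mul_selPdf [IsFiniteMeasure P] :
    IntegrableOn (fun t => marcumQ (ν + 1) √(2 * t * μ n ^ 2 / (1 - μ n ^ 2))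
      √(2 * r / (1 - μ n ^ 2)) * selPdf (ν + 1) ρ n t) (Ioi 0) := by
  have h_meas : AEMeasurable (fun t => marcumQ (ν + 1) √(2 * t * μ n ^ 2 / (1 - μ n ^ 2))
      √(2 * r / (1 - μ n ^ 2)) * selPdf (ν + 1) ρ n t) (volume.restrict (Ioi 0)) :=
    (measurable_marcumQ_succ_sqrt ν (by fun_prop) (by fun_prop)).aemeasurable.mul
      (aemeasurable_selPdf_succ ν hρ n)
  refine (lintegral_ofReal_ne_top_iff_integrable h_meas.aestronglyMeasurable
    (ae_marcumQ_mul_selPdf_nonneg hρ n _ (Real.sqrt_nonneg _))).1 ?_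
  rw [← hG.measure_selected_inter_lt hρ hmax n hμ hr]
  exact measure_ne_top P _

lemma IsGaussianModel.measureReal_selected_inter_lt [IsFiniteMeasure P] :
    P.real ({ω | s ω = n} ∩ {ω | r < outdatedGain ρ μ xh yh x y n ω})
      = ∫ t in Ioi 0, marcumQ (ν + 1) √(2 * t * μ n ^ 2 / (1 - μ n ^ 2))
          √(2 * r / (1 - μ n ^ 2)) * selPdf (ν + 1) ρ n t := by
  have h_nonneg := ae_marcumQ_mul_selPdf_nonneg (ν := ν) hρ n
    (fun t => √(2 * t * μ n ^ 2 / (1 - μ n ^ 2))) (Real.sqrt_nonneg (2 * r / (1 - μ n ^ 2)))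
  rw [measureReal_def, hG.measure_selected_inter_lt hρ hmax n hμ hr,
    ← ofReal_integral_eq_lintegral_ofReal
      (hG.integrableOn_marcumQ_mul_selPdf hρ hmax n hμ hr) h_nonneg,
    ENNReal.toReal_ofReal (integral_nonneg_of_ae h_nonneg)]

end Port

end FluidAntenna

end

theorem theorem2 {Ω : Type*} [MeasurableSpace Ω] (P : Measure Ω) [IsProbabilityMeasure P]
    (N m : ℕ) [NeZero N] (hm : 1 ≤ m)
    (ρ μ : Fin N → ℝ) (hρ : ∀ n, n ≠ 0 → |ρ n| < 1) (hμ : ∀ n, |μ n| < 1)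
    (xh yh x y : Fin N → Fin m → Ω → ℝ)
    (hG : FluidAntenna.IsGaussianModel P xh yh x y)
    -- the activated port has the largest estimated gain; ties are broken arbitrarily
    (s : Ω → Fin N) (hs : Measurable s)
    (hmax : ∀ ω n, FluidAntenna.estGain ρ xh yh n ω ≤ FluidAntenna.estGain ρ xh yh (s ω) ω) :
    -- `selPdf m ρ n` is the density of the estimated gain of port `n` on the event `s = n`
    (∀ n, (P.restrict {ω | s ω = n}).map (FluidAntenna.estGain ρ xh yh n)
        = (volume.restrict (Ioi (0 : ℝ))).withDensity
            (fun t => ENNReal.ofReal (FluidAntenna.selPdf m ρ n t))) ∧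
    (∀ n, ∀ t > 0, 0 ≤ FluidAntenna.selPdf m ρ n t) ∧
    ∀ r : ℝ, 0 ≤ r →
      (∀ n, IntegrableOn (fun t =>
          FluidAntenna.marcumQ m (√(2 * t * μ n ^ 2 / (1 - μ n ^ 2))) (√(2 * r / (1 - μ n ^ 2)))
            * FluidAntenna.selPdf m ρ n t) (Ioi 0)) ∧
      cdf (P.map (fun ω => FluidAntenna.outdatedGain ρ μ xh yh x y (s ω) ω)) r
        = 1 - ∑ n, ∫ t in Ioi (0 : ℝ),
            FluidAntenna.marcumQ m (√(2 * t * μ n ^ 2 / (1 - μ n ^ 2))) (√(2 * r / (1 - μ n ^ 2)))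
              * FluidAntenna.selPdf m ρ n t := by
  obtain ⟨ν, rfl⟩ := Nat.exists_eq_add_of_le' hm
  refine ⟨hG.map_estGain_restrict hρ hmax,
    fun n t ht => FluidAntenna.selPdf_succ_nonneg ν hρ n (le_of_lt ht), fun r hr =>
    ⟨fun n => hG.integrableOn_marcumQ_mul_selPdf hρ hmax n (hμ n) hr, ?_⟩⟩
  rw [FluidAntenna.cdf_map_apply_selected hs (hG.aemeasurable_outdatedGain μ) r]
  simp_rw [hG.measureReal_selected_inter_lt hρ hmax _ (hμ _) hr]
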